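/- Both languages below are call-by-value; terms are taken up to renaming of bound variables, and substitution is capture-avoiding. **Common part.** Terms are $$t ::= \mathsf{unit} \mid \mathsf{true} \mid \mathsf{false} \mid x \mid \lambda x{:}\tau.\,t \mid t\,t \mid \langle t,t\rangle \mid t.1 \mid t.2 \mid \mathsf{inl}\,t \mid \mathsf{inr}\,t \mid \mathsf{case}\ t\ \mathsf{of}\ \mathsf{inl}\,x_1\mapsto t \mid \mathsf{inr}\,x_2\mapsto t \mid \mathsf{if}\ t\ \mathsf{then}\ t\ \mathsf{else}\ t \mid t;t$$ over the types $\mathsf{Unit}$, $\mathsf{Bool}$, $\tau\to\tau$, $\tau\times\tau$, $\tau\uplus\tau$, with the standard typing rules $\Gamma\vdash t:\tau$ of the simply typed lambda calculus ($t;t'$ has the type of $t'$ and requires $t:\mathsf{Unit}$). Values are $\mathsf{unit}$, $\mathsf{true}$, $\mathsf{false}$, abstractions, pairs of values and injections of values. Reduction $t\hookrightarrow t'$ is the standard left-to-right call-by-value small-step reduction under evaluation contexts. **The source language $\lambda^{\mathsf{fix}}$** adds terms $\mathsf{fix}_{\tau_1\to\tau_2}\,t$ with the typing rule $$\frac{\Gamma\vdash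 t:(\tau_1\to\tau_2)\to\tau_1\to\tau_2}{\Gamma\vdash \mathsf{fix}_{\tau_1\to\tau_2}\,t:\tau_1\to\tau_2},$$ evaluation under $\mathsf{fix}$, and the primitive reduction $$\mathsf{fix}_{\tau_1\to\tau_2}\,(\lambda x{:}\tau_1\to\tau_2.\,t)\ \hookrightarrow\ t\big[\,\lambda y{:}\tau_1.\,\mathsf{fix}_{\tau_1\to\tau_2}\,(\lambda x{:}\tau_1\to\tau_2.\,t)\;y\,/\,x\,\big]\qquad (y \text{ fresh}).$$ **The target language $\lambda^{\mu}_{i}$** adds instead iso-recursive types $\mu\alpha.\tau$. All its types are closed and contractive (the body of a $\mu$ is never a type variable). It has terms $\mathsf{fold}_{\mu\alpha.\tau}\,t$ and $\mathsf{unfold}_{\mu\alpha.\tau}\,t$ with typing rules $$\frac{\Gamma\vdash t:\tau[\mu\alpha.\tau/\alpha]}{\Gamma\vdash\mathsf{fold}_{\mu\alpha.\tau}\,t:\mu\alpha.\tau},\qquad \frac{\Gamma\vdash t:\mu\alpha.\tau}{\Gamma\vdash\mathsf{unfold}_{\mu\alpha.\tau}\,t:\tau[\mu\alpha.\tau/\alpha]},$$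 evaluation under both, values $\mathsf{fold}_{\mu\alpha.\tau}\,v$ for values $v$, and the primitive reduction $\mathsf{unfold}_{\mu\alpha.\tau}(\mathsf{fold}_{\mu\alpha.\tau}\,v)\hookrightarrow v$. **Contextual equivalence.** In each language, $t\Downarrow$ means that $t$ reduces to a value in some finite number of steps. A program context $\mathfrak C$ is a term with exactly one hole, possibly under binders; $\mathfrak C:\Gamma,\tau\to\Gamma',\tau'$ is the usual typing judgement, saying that the hole has type $\tau$ in environment $\Gamma$ and the whole has type $\tau'$ in environment $\Gamma'$. Define $\Gamma\vdash t_1\simeq t_2:\tau$ to mean that $\Gamma\vdash t_1:\tau$, $\Gamma\vdash t_2:\tau$, and for every type $\tau'$ and every program context $\mathfrak C:\Gamma,\tau\to\emptyset,\tau'$ of the language, $\mathfrak C[t_1]\Downarrow$ if and only if $\mathfrak C[t_2]\Downarrow$. **The compiler** $[\![\cdot]\!]$ from $\lambda^{\mathsf{fix}}$ to $\lambda^{\mu}_{i}$ is the identity on types (source types are target types without $\mu$), commutes with every term constructor other than $\mathsf{fix}$, and is given on $\mathsf{fix}$ by $$[\![\mathsf{fix}_{\tau_1\to\tau_2}\,t]\!]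 = \big(\lambda f{:}(\tau_1\to\tau_2)\to\tau_1\to\tau_2.\; Z_f\,(\mathsf{fold}_{\rho}\,Z_f)\big)\,[\![t]\!],$$ $$\rho=\mu\alpha.\,\alpha\to(\tau_1\to\tau_2),\qquad Z_f=\lambda x{:}\rho.\; f\,\big(\lambda y{:}\tau_1.\,((\mathsf{unfold}_{\rho}\,x)\,x)\,y\big).$$ **Theorem** (the compiler is fully abstract). For all terms $t_1,t_2$ of $\lambda^{\mathsf{fix}}$ and every type $\tau$ of $\lambda^{\mathsf{fix}}$, $$\emptyset\vdash t_1\simeq t_2:\tau\ \text{ in } \lambda^{\mathsf{fix}}\iff \emptyset\vdash[\![t_1]\!]\simeq[\![t_2]\!]:[\![\tau]\!]\ \text{ in } \lambda^{\mu}_{i}.$$ -/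

import Mathlib

/-!
Two call-by-value languages: `FixLang`, the simply typed lambda calculus with a typed fixpoint
operator, and `IsoLang`, the simply typed lambda calculus with iso-recursive types, together with
the canonical compiler from the first to the second.

Variables are de Bruijn indices. A typing environment is a list of types whose head is the type of
index `0`. Terms that are equal up to renaming of bound variables are equal.
-/

/-- Lift a renaming of indices under one binder. -/
def liftRen (ρ : ℕ → ℕ) : ℕ → ℕ
  | 0 => 0
  | i + 1 => ρ i + 1

namespace FixLang

/-- Types of the calculus with fixpoints. -/
inductive Ty : Type
  | unit : Ty
  | bool : Ty
  | arrow : Ty → Ty → Ty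
  | prod : Ty → Ty → Ty
  | sum : Ty → Ty → Ty

/-- Terms. `lam τ t` is `λ x : τ. t`; in `caseOf t t₁ t₂` each branch binds one variable.
`fix τ₁ τ₂ t` is the fixpoint operator annotated with `τ₁ → τ₂`, applied to `t`. -/
inductive Tm : Type
  | unit : Tm
  | tt : Tm
  | ff : Tm
  | var : ℕ → Tm
  | lam : Ty → Tm → Tm
  | app : Tm → Tm → Tm
  | fst : Tm → Tm
  | snd : Tm → Tm
  | pair : Tm → Tm → Tm
  | inl : Tm → Tm
  | inr : Tm → Tm
  | caseOf : Tm → Tm → Tm → Tm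
  | ite : Tm → Tm → Tm → Tm
  | seq : Tm → Tm → Tm
  | fix : Ty → Ty → Tm → Tm

namespace Tm

/-- Renaming of term variables. -/
def rename : Tm → (ℕ → ℕ) → Tm
  | unit, _ => unit
  | tt, _ => tt
  | ff, _ => ff
  | var i, ρ => var (ρ i)
  | lam τ t, ρ => lam τ (t.rename (liftRen ρ))
  | app t u, ρ => app (t.rename ρ) (u.rename ρ)
  | fst t, ρ => fst (t.rename ρ)
  | snd t, ρ => snd (t.rename ρ)
  | pair t u, ρ => pair (t.rename ρ) (u.rename ρ)
  | inl t, ρ => inl (t.rename ρ)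
  | inr t, ρ => inr (t.rename ρ)
  | caseOf t u w, ρ => caseOf (t.rename ρ) (u.rename (liftRen ρ)) (w.rename (liftRen ρ))
  | ite t u w, ρ => ite (t.rename ρ) (u.rename ρ) (w.rename ρ)
  | seq t u, ρ => seq (t.rename ρ) (u.rename ρ)
  | fix σ τ t, ρ => fix σ τ (t.rename ρ)

/-- Lift a substitution of terms for term variables under one binder. -/
def liftSub (θ : ℕ → Tm) : ℕ → Tm
  | 0 => var 0
  | i + 1 => (θ i).rename Nat.succ

/-- Simultaneous capture-avoiding substitution of terms for term variables. -/
def subst : Tm → (ℕ → Tm) → Tm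
  | unit, _ => unit
  | tt, _ => tt
  | ff, _ => ff
  | var i, θ => θ i
  | lam τ t, θ => lam τ (t.subst (liftSub θ))
  | app t u, θ => app (t.subst θ) (u.subst θ)
  | fst t, θ => fst (t.subst θ)
  | snd t, θ => snd (t.subst θ)
  | pair t u, θ => pair (t.subst θ) (u.subst θ)
  | inl t, θ => inl (t.subst θ)
  | inr t, θ => inr (t.subst θ)
  | caseOf t u w, θ => caseOf (t.subst θ) (u.subst (liftSub θ)) (w.subst (liftSub θ))
  | ite t u w, θ => ite (t.subst θ) (u.subst θ) (w.subst θ)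
  | seq t u, θ => seq (t.subst θ) (u.subst θ)
  | fix σ τ t, θ => fix σ τ (t.subst θ)

/-- The substitution that replaces index `0` by `u` and lowers the other indices. -/
def single (u : Tm) : ℕ → Tm
  | 0 => u
  | i + 1 => var i

/-- `t[u / x]`, where `x` is index `0` in `t`. -/
def subst0 (t u : Tm) : Tm := t.subst (single u)

end Tm

/-- Values. -/
inductive Value : Tm → Prop
  | unit : Value Tm.unit
  | tt : Value Tm.tt
  | ff : Value Tm.ff
  | lam (τ : Ty) (t : Tm) : Value (Tm.lam τ t)
  | pair {v w : Tm} : Value v → Value w → Value (Tm.pair v w)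
  | inl {v : Tm} : Value v → Value (Tm.inl v)
  | inr {v : Tm} : Value v → Value (Tm.inr v)

/-- Typing `Γ ⊢ t : τ`. -/
inductive HasType : List Ty → Tm → Ty → Prop
  | var {Γ : List Ty} {i : ℕ} {τ : Ty} : Γ[i]? = some τ → HasType Γ (Tm.var i) τ
  | unit {Γ : List Ty} : HasType Γ Tm.unit Ty.unit
  | tt {Γ : List Ty} : HasType Γ Tm.tt Ty.bool
  | ff {Γ : List Ty} : HasType Γ Tm.ff Ty.bool
  | lam {Γ : List Ty} {σ τ : Ty} {t : Tm} :
      HasType (σ :: Γ) t τ → HasType Γ (Tm.lam σ t) (Ty.arrow σ τ)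
  | app {Γ : List Ty} {σ τ : Ty} {t u : Tm} :
      HasType Γ t (Ty.arrow σ τ) → HasType Γ u σ → HasType Γ (Tm.app t u) τ
  | fst {Γ : List Ty} {σ τ : Ty} {t : Tm} :
      HasType Γ t (Ty.prod σ τ) → HasType Γ (Tm.fst t) σ
  | snd {Γ : List Ty} {σ τ : Ty} {t : Tm} :
      HasType Γ t (Ty.prod σ τ) → HasType Γ (Tm.snd t) τ
  | pair {Γ : List Ty} {σ τ : Ty} {t u : Tm} :
      HasType Γ t σ → HasType Γ u τ → HasType Γ (Tm.pair t u) (Ty.prod σ τ)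
  | inl {Γ : List Ty} {σ τ : Ty} {t : Tm} :
      HasType Γ t σ → HasType Γ (Tm.inl t) (Ty.sum σ τ)
  | inr {Γ : List Ty} {σ τ : Ty} {t : Tm} :
      HasType Γ t τ → HasType Γ (Tm.inr t) (Ty.sum σ τ)
  | caseOf {Γ : List Ty} {σ₁ σ₂ τ : Ty} {t t₁ t₂ : Tm} :
      HasType Γ t (Ty.sum σ₁ σ₂) → HasType (σ₁ :: Γ) t₁ τ → HasType (σ₂ :: Γ) t₂ τ →
      HasType Γ (Tm.caseOf t t₁ t₂) τ
  | ite {Γ : List Ty} {τ : Ty} {t t₁ t₂ : Tm} :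
      HasType Γ t Ty.bool → HasType Γ t₁ τ → HasType Γ t₂ τ → HasType Γ (Tm.ite t t₁ t₂) τ
  | seq {Γ : List Ty} {τ : Ty} {t u : Tm} :
      HasType Γ t Ty.unit → HasType Γ u τ → HasType Γ (Tm.seq t u) τ
  | fix {Γ : List Ty} {τ₁ τ₂ : Ty} {t : Tm} :
      HasType Γ t (Ty.arrow (Ty.arrow τ₁ τ₂) (Ty.arrow τ₁ τ₂)) →
      HasType Γ (Tm.fix τ₁ τ₂ t) (Ty.arrow τ₁ τ₂)

/-- Program contexts: terms with exactly one hole, which may lie under binders. -/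
inductive Ctx : Type
  | hole : Ctx
  | lam : Ty → Ctx → Ctx
  | appL : Ctx → Tm → Ctx
  | appR : Tm → Ctx → Ctx
  | fst : Ctx → Ctx
  | snd : Ctx → Ctx
  | pairL : Ctx → Tm → Ctx
  | pairR : Tm → Ctx → Ctx
  | inl : Ctx → Ctx
  | inr : Ctx → Ctx
  | case₁ : Ctx → Tm → Tm → Ctx
  | case₂ : Tm → Ctx → Tm → Ctx
  | case₃ : Tm → Tm → Ctx → Ctx
  | ite₁ : Ctx → Tm → Tm → Ctx
  | ite₂ : Tm → Ctx → Tm → Ctx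
  | ite₃ : Tm → Tm → Ctx → Ctx
  | seqL : Ctx → Tm → Ctx
  | seqR : Tm → Ctx → Ctx
  | fix : Ty → Ty → Ctx → Ctx

namespace Ctx

/-- `C.plug t` is `C[t]`: the hole is replaced by `t`, whose free variables may be captured by the
binders of `C` above the hole. -/
def plug : Ctx → Tm → Tm
  | hole, t => t
  | lam τ C, t => Tm.lam τ (C.plug t)
  | appL C u, t => Tm.app (C.plug t) u
  | appR u C, t => Tm.app u (C.plug t)
  | fst C, t => Tm.fst (C.plug t)
  | snd C, t => Tm.snd (C.plug t)
  | pairL C u, t => Tm.pair (C.plug t) u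
  | pairR u C, t => Tm.pair u (C.plug t)
  | inl C, t => Tm.inl (C.plug t)
  | inr C, t => Tm.inr (C.plug t)
  | case₁ C u w, t => Tm.caseOf (C.plug t) u w
  | case₂ s C w, t => Tm.caseOf s (C.plug t) w
  | case₃ s u C, t => Tm.caseOf s u (C.plug t)
  | ite₁ C u w, t => Tm.ite (C.plug t) u w
  | ite₂ s C w, t => Tm.ite s (C.plug t) w
  | ite₃ s u C, t => Tm.ite s u (C.plug t)
  | seqL C u, t => Tm.seq (C.plug t) u
  | seqR u C, t => Tm.seq u (C.plug t)
  | fix σ τ C, t => Tm.fix σ τ (C.plug t)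

/-- Evaluation contexts, as particular program contexts. -/
inductive IsEval : Ctx → Prop
  | hole : IsEval hole
  | appL {E : Ctx} (t : Tm) : IsEval E → IsEval (appL E t)
  | appR {v : Tm} {E : Ctx} : Value v → IsEval E → IsEval (appR v E)
  | fst {E : Ctx} : IsEval E → IsEval (fst E)
  | snd {E : Ctx} : IsEval E → IsEval (snd E)
  | pairL {E : Ctx} (t : Tm) : IsEval E → IsEval (pairL E t)
  | pairR {v : Tm} {E : Ctx} : Value v → IsEval E → IsEval (pairR v E)
  | inl {E : Ctx} : IsEval E → IsEval (inl E)
  | inr {E : Ctx} : IsEval E → IsEval (inr E)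
  | case₁ {E : Ctx} (t₁ t₂ : Tm) : IsEval E → IsEval (case₁ E t₁ t₂)
  | ite₁ {E : Ctx} (t₁ t₂ : Tm) : IsEval E → IsEval (ite₁ E t₁ t₂)
  | seqL {E : Ctx} (t : Tm) : IsEval E → IsEval (seqL E t)
  | fix {E : Ctx} (σ τ : Ty) : IsEval E → IsEval (fix σ τ E)

/-- `HasType C Γ τ Γ' τ'` is the judgement `⊢ C : Γ, τ → Γ', τ'`: the hole has type `τ` in the
environment `Γ`, and the whole has type `τ'` in the environment `Γ'`. -/
inductive HasType : Ctx → List Ty → Ty → List Ty → Ty → Prop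
  | hole {Γ : List Ty} {τ : Ty} : HasType hole Γ τ Γ τ
  | lam {Γ₀ Γ : List Ty} {τ₀ σ τ : Ty} {C : Ctx} :
      HasType C Γ₀ τ₀ (σ :: Γ) τ → HasType (lam σ C) Γ₀ τ₀ Γ (Ty.arrow σ τ)
  | appL {Γ₀ Γ : List Ty} {τ₀ σ τ : Ty} {C : Ctx} {u : Tm} :
      HasType C Γ₀ τ₀ Γ (Ty.arrow σ τ) → FixLang.HasType Γ u σ → HasType (appL C u) Γ₀ τ₀ Γ τ
  | appR {Γ₀ Γ : List Ty} {τ₀ σ τ : Ty} {C : Ctx} {u : Tm} :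
      FixLang.HasType Γ u (Ty.arrow σ τ) → HasType C Γ₀ τ₀ Γ σ → HasType (appR u C) Γ₀ τ₀ Γ τ
  | fst {Γ₀ Γ : List Ty} {τ₀ σ τ : Ty} {C : Ctx} :
      HasType C Γ₀ τ₀ Γ (Ty.prod σ τ) → HasType (fst C) Γ₀ τ₀ Γ σ
  | snd {Γ₀ Γ : List Ty} {τ₀ σ τ : Ty} {C : Ctx} :
      HasType C Γ₀ τ₀ Γ (Ty.prod σ τ) → HasType (snd C) Γ₀ τ₀ Γ τ
  | pairL {Γ₀ Γ : List Ty} {τ₀ σ τ : Ty} {C : Ctx} {u : Tm} :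
      HasType C Γ₀ τ₀ Γ σ → FixLang.HasType Γ u τ → HasType (pairL C u) Γ₀ τ₀ Γ (Ty.prod σ τ)
  | pairR {Γ₀ Γ : List Ty} {τ₀ σ τ : Ty} {C : Ctx} {u : Tm} :
      FixLang.HasType Γ u σ → HasType C Γ₀ τ₀ Γ τ → HasType (pairR u C) Γ₀ τ₀ Γ (Ty.prod σ τ)
  | inl {Γ₀ Γ : List Ty} {τ₀ σ τ : Ty} {C : Ctx} :
      HasType C Γ₀ τ₀ Γ σ → HasType (inl C) Γ₀ τ₀ Γ (Ty.sum σ τ)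
  | inr {Γ₀ Γ : List Ty} {τ₀ σ τ : Ty} {C : Ctx} :
      HasType C Γ₀ τ₀ Γ τ → HasType (inr C) Γ₀ τ₀ Γ (Ty.sum σ τ)
  | case₁ {Γ₀ Γ : List Ty} {τ₀ σ₁ σ₂ τ : Ty} {C : Ctx} {t₁ t₂ : Tm} :
      HasType C Γ₀ τ₀ Γ (Ty.sum σ₁ σ₂) → FixLang.HasType (σ₁ :: Γ) t₁ τ →
      FixLang.HasType (σ₂ :: Γ) t₂ τ → HasType (case₁ C t₁ t₂) Γ₀ τ₀ Γ τ
  | case₂ {Γ₀ Γ : List Ty} {τ₀ σ₁ σ₂ τ : Ty} {C : Ctx} {t t₂ : Tm} :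
      FixLang.HasType Γ t (Ty.sum σ₁ σ₂) → HasType C Γ₀ τ₀ (σ₁ :: Γ) τ →
      FixLang.HasType (σ₂ :: Γ) t₂ τ → HasType (case₂ t C t₂) Γ₀ τ₀ Γ τ
  | case₃ {Γ₀ Γ : List Ty} {τ₀ σ₁ σ₂ τ : Ty} {C : Ctx} {t t₁ : Tm} :
      FixLang.HasType Γ t (Ty.sum σ₁ σ₂) → FixLang.HasType (σ₁ :: Γ) t₁ τ →
      HasType C Γ₀ τ₀ (σ₂ :: Γ) τ → HasType (case₃ t t₁ C) Γ₀ τ₀ Γ τ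
  | ite₁ {Γ₀ Γ : List Ty} {τ₀ τ : Ty} {C : Ctx} {t₁ t₂ : Tm} :
      HasType C Γ₀ τ₀ Γ Ty.bool → FixLang.HasType Γ t₁ τ → FixLang.HasType Γ t₂ τ →
      HasType (ite₁ C t₁ t₂) Γ₀ τ₀ Γ τ
  | ite₂ {Γ₀ Γ : List Ty} {τ₀ τ : Ty} {C : Ctx} {t t₂ : Tm} :
      FixLang.HasType Γ t Ty.bool → HasType C Γ₀ τ₀ Γ τ → FixLang.HasType Γ t₂ τ →
      HasType (ite₂ t C t₂) Γ₀ τ₀ Γ τ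
  | ite₃ {Γ₀ Γ : List Ty} {τ₀ τ : Ty} {C : Ctx} {t t₁ : Tm} :
      FixLang.HasType Γ t Ty.bool → FixLang.HasType Γ t₁ τ → HasType C Γ₀ τ₀ Γ τ →
      HasType (ite₃ t t₁ C) Γ₀ τ₀ Γ τ
  | seqL {Γ₀ Γ : List Ty} {τ₀ τ : Ty} {C : Ctx} {u : Tm} :
      HasType C Γ₀ τ₀ Γ Ty.unit → FixLang.HasType Γ u τ → HasType (seqL C u) Γ₀ τ₀ Γ τ
  | seqR {Γ₀ Γ : List Ty} {τ₀ τ : Ty} {C : Ctx} {u : Tm} :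
      FixLang.HasType Γ u Ty.unit → HasType C Γ₀ τ₀ Γ τ → HasType (seqR u C) Γ₀ τ₀ Γ τ
  | fix {Γ₀ Γ : List Ty} {τ₀ τ₁ τ₂ : Ty} {C : Ctx} :
      HasType C Γ₀ τ₀ Γ (Ty.arrow (Ty.arrow τ₁ τ₂) (Ty.arrow τ₁ τ₂)) →
      HasType (fix τ₁ τ₂ C) Γ₀ τ₀ Γ (Ty.arrow τ₁ τ₂)

end Ctx

/-- Primitive reduction. In the rule for `fix` the recursive call is the value
`λ y : τ₁. fix_{τ₁ → τ₂} (λ x : τ₁ → τ₂. t) y`, as call by value demands; the renaming moves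
`λ x. t` under the binder `y`. -/
inductive Prim : Tm → Tm → Prop
  | beta {τ : Ty} {t v : Tm} : Value v → Prim (Tm.app (Tm.lam τ t) v) (t.subst0 v)
  | fst {v w : Tm} : Value v → Value w → Prim (Tm.fst (Tm.pair v w)) v
  | snd {v w : Tm} : Value v → Value w → Prim (Tm.snd (Tm.pair v w)) w
  | seq {t : Tm} : Prim (Tm.seq Tm.unit t) t
  | caseInl {v t₁ t₂ : Tm} : Value v → Prim (Tm.caseOf (Tm.inl v) t₁ t₂) (t₁.subst0 v)
  | caseInr {v t₁ t₂ : Tm} : Value v → Prim (Tm.caseOf (Tm.inr v) t₁ t₂) (t₂.subst0 v)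
  | iteTrue {t₁ t₂ : Tm} : Prim (Tm.ite Tm.tt t₁ t₂) t₁
  | iteFalse {t₁ t₂ : Tm} : Prim (Tm.ite Tm.ff t₁ t₂) t₂
  | fix {τ₁ τ₂ : Ty} {t : Tm} :
      Prim (Tm.fix τ₁ τ₂ (Tm.lam (Ty.arrow τ₁ τ₂) t))
        (t.subst0 (Tm.lam τ₁ (Tm.app
          (Tm.fix τ₁ τ₂ ((Tm.lam (Ty.arrow τ₁ τ₂) t).rename Nat.succ)) (Tm.var 0))))

/-- Reduction: a primitive reduction inside an evaluation context. -/
inductive Red : Tm → Tm → Prop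
  | ctx {E : Ctx} {t t' : Tm} : E.IsEval → Prim t t' → Red (E.plug t) (E.plug t')

/-- `TerminatesIn t n v`: the term `t` reduces to the value `v` in `n` steps. -/
inductive TerminatesIn : Tm → ℕ → Tm → Prop
  | value {v : Tm} : Value v → TerminatesIn v 0 v
  | step {t t' v : Tm} {n : ℕ} : Red t t' → TerminatesIn t' n v → TerminatesIn t (n + 1) v

/-- The term `t` terminates. -/
def Terminates (t : Tm) : Prop := ∃ (n : ℕ) (v : Tm), TerminatesIn t n v

/-- Contextual equivalence `Γ ⊢ t₁ ≃ t₂ : τ`: both terms have type `τ` in `Γ`, and every program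
context for that type and environment that yields a closed program of some type `τ'` terminates
with the one if and only if it terminates with the other. -/
def CtxEquiv (Γ : List Ty) (t₁ t₂ : Tm) (τ : Ty) : Prop :=
  HasType Γ t₁ τ ∧ HasType Γ t₂ τ ∧
    ∀ (C : Ctx) (τ' : Ty), C.HasType Γ τ [] τ' →
      (Terminates (C.plug t₁) ↔ Terminates (C.plug t₂))

end FixLang

namespace IsoLang

/-- Raw types with type variables; `mu τ` is the recursive type `μ α. τ`, whose variable `α` is
index `0` in `τ`. -/
inductive Ty : Type
  | unit : Ty
  | bool : Ty
  | arrow : Ty → Ty → Ty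
  | prod : Ty → Ty → Ty
  | sum : Ty → Ty → Ty
  | mu : Ty → Ty
  | var : ℕ → Ty

namespace Ty

/-- Renaming of type variables. -/
def rename : Ty → (ℕ → ℕ) → Ty
  | unit, _ => unit
  | bool, _ => bool
  | arrow σ τ, ρ => arrow (σ.rename ρ) (τ.rename ρ)
  | prod σ τ, ρ => prod (σ.rename ρ) (τ.rename ρ)
  | sum σ τ, ρ => sum (σ.rename ρ) (τ.rename ρ)
  | mu τ, ρ => mu (τ.rename (liftRen ρ))
  | var i, ρ => var (ρ i)

/-- Lift a substitution of types for type variables under one binder. -/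
def liftSub (θ : ℕ → Ty) : ℕ → Ty
  | 0 => var 0
  | i + 1 => (θ i).rename Nat.succ

/-- Simultaneous capture-avoiding substitution of types for type variables. -/
def subst : Ty → (ℕ → Ty) → Ty
  | unit, _ => unit
  | bool, _ => bool
  | arrow σ τ, θ => arrow (σ.subst θ) (τ.subst θ)
  | prod σ τ, θ => prod (σ.subst θ) (τ.subst θ)
  | sum σ τ, θ => sum (σ.subst θ) (τ.subst θ)
  | mu τ, θ => mu (τ.subst (liftSub θ))
  | var i, θ => θ i

/-- The substitution that replaces index `0` by `σ` and lowers the other indices. -/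
def single (σ : Ty) : ℕ → Ty
  | 0 => σ
  | i + 1 => var i

/-- The unfolding `τ[μ α. τ / α]` of `μ α. τ`, as a function of the body `τ`. -/
def unfolding (τ : Ty) : Ty := τ.subst (single (mu τ))

/-- The type is a type variable. -/
def IsVar : Ty → Prop
  | var _ => True
  | _ => False

/-- All free type variables are among the first `n` and every recursive subterm is contractive:
the body of a `mu` is never a type variable, so a bound variable occurs only below one of the
constructors `arrow`, `prod`, `sum`. -/
def WF : ℕ → Ty → Prop
  | _, unit => True
  | _, bool => True
  | n, arrow σ τ => WF n σ ∧ WF n τ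
  | n, prod σ τ => WF n σ ∧ WF n τ
  | n, sum σ τ => WF n σ ∧ WF n τ
  | n, mu τ => ¬ τ.IsVar ∧ WF (n + 1) τ
  | n, var i => i < n

/-- The types of the calculus: closed, with contractive recursion only. -/
def Valid (τ : Ty) : Prop := WF 0 τ

end Ty

/-- Terms. `lam τ t` is `λ x : τ. t`; in `caseOf t t₁ t₂` each branch binds one variable.
`fold τ t` and `unfold τ t` carry the annotation `μ α. τ`, of which `τ` is the body. -/
inductive Tm : Type
  | unit : Tm
  | tt : Tm
  | ff : Tm
  | var : ℕ → Tm
  | lam : Ty → Tm → Tm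
  | app : Tm → Tm → Tm
  | fst : Tm → Tm
  | snd : Tm → Tm
  | pair : Tm → Tm → Tm
  | inl : Tm → Tm
  | inr : Tm → Tm
  | caseOf : Tm → Tm → Tm → Tm
  | ite : Tm → Tm → Tm → Tm
  | seq : Tm → Tm → Tm
  | fold : Ty → Tm → Tm
  | unfold : Ty → Tm → Tm

namespace Tm

/-- Renaming of term variables. -/
def rename : Tm → (ℕ → ℕ) → Tm
  | unit, _ => unit
  | tt, _ => tt
  | ff, _ => ff
  | var i, ρ => var (ρ i)
  | lam τ t, ρ => lam τ (t.rename (liftRen ρ))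
  | app t u, ρ => app (t.rename ρ) (u.rename ρ)
  | fst t, ρ => fst (t.rename ρ)
  | snd t, ρ => snd (t.rename ρ)
  | pair t u, ρ => pair (t.rename ρ) (u.rename ρ)
  | inl t, ρ => inl (t.rename ρ)
  | inr t, ρ => inr (t.rename ρ)
  | caseOf t u w, ρ => caseOf (t.rename ρ) (u.rename (liftRen ρ)) (w.rename (liftRen ρ))
  | ite t u w, ρ => ite (t.rename ρ) (u.rename ρ) (w.rename ρ)
  | seq t u, ρ => seq (t.rename ρ) (u.rename ρ)
  | fold τ t, ρ => fold τ (t.rename ρ)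
  | unfold τ t, ρ => unfold τ (t.rename ρ)

/-- Lift a substitution of terms for term variables under one binder. -/
def liftSub (θ : ℕ → Tm) : ℕ → Tm
  | 0 => var 0
  | i + 1 => (θ i).rename Nat.succ

/-- Simultaneous capture-avoiding substitution of terms for term variables. -/
def subst : Tm → (ℕ → Tm) → Tm
  | unit, _ => unit
  | tt, _ => tt
  | ff, _ => ff
  | var i, θ => θ i
  | lam τ t, θ => lam τ (t.subst (liftSub θ))
  | app t u, θ => app (t.subst θ) (u.subst θ)
  | fst t, θ => fst (t.subst θ)
  | snd t, θ => snd (t.subst θ)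
  | pair t u, θ => pair (t.subst θ) (u.subst θ)
  | inl t, θ => inl (t.subst θ)
  | inr t, θ => inr (t.subst θ)
  | caseOf t u w, θ => caseOf (t.subst θ) (u.subst (liftSub θ)) (w.subst (liftSub θ))
  | ite t u w, θ => ite (t.subst θ) (u.subst θ) (w.subst θ)
  | seq t u, θ => seq (t.subst θ) (u.subst θ)
  | fold τ t, θ => fold τ (t.subst θ)
  | unfold τ t, θ => unfold τ (t.subst θ)

/-- The substitution that replaces index `0` by `u` and lowers the other indices. -/
def single (u : Tm) : ℕ → Tm
  | 0 => u
  | i + 1 => var i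

/-- `t[u / x]`, where `x` is index `0` in `t`. -/
def subst0 (t u : Tm) : Tm := t.subst (single u)

end Tm

/-- Values. -/
inductive Value : Tm → Prop
  | unit : Value Tm.unit
  | tt : Value Tm.tt
  | ff : Value Tm.ff
  | lam (τ : Ty) (t : Tm) : Value (Tm.lam τ t)
  | pair {v w : Tm} : Value v → Value w → Value (Tm.pair v w)
  | inl {v : Tm} : Value v → Value (Tm.inl v)
  | inr {v : Tm} : Value v → Value (Tm.inr v)
  | fold {τ : Ty} {v : Tm} : Value v → Value (Tm.fold τ v)

/-- Typing `Γ ⊢ t : τ`. -/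
inductive HasType : List Ty → Tm → Ty → Prop
  | var {Γ : List Ty} {i : ℕ} {τ : Ty} : Γ[i]? = some τ → HasType Γ (Tm.var i) τ
  | unit {Γ : List Ty} : HasType Γ Tm.unit Ty.unit
  | tt {Γ : List Ty} : HasType Γ Tm.tt Ty.bool
  | ff {Γ : List Ty} : HasType Γ Tm.ff Ty.bool
  | lam {Γ : List Ty} {σ τ : Ty} {t : Tm} :
      σ.Valid → HasType (σ :: Γ) t τ → HasType Γ (Tm.lam σ t) (Ty.arrow σ τ)
  | app {Γ : List Ty} {σ τ : Ty} {t u : Tm} :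
      HasType Γ t (Ty.arrow σ τ) → HasType Γ u σ → HasType Γ (Tm.app t u) τ
  | fst {Γ : List Ty} {σ τ : Ty} {t : Tm} :
      HasType Γ t (Ty.prod σ τ) → HasType Γ (Tm.fst t) σ
  | snd {Γ : List Ty} {σ τ : Ty} {t : Tm} :
      HasType Γ t (Ty.prod σ τ) → HasType Γ (Tm.snd t) τ
  | pair {Γ : List Ty} {σ τ : Ty} {t u : Tm} :
      HasType Γ t σ → HasType Γ u τ → HasType Γ (Tm.pair t u) (Ty.prod σ τ)
  | inl {Γ : List Ty} {σ τ : Ty} {t : Tm} :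
      τ.Valid → HasType Γ t σ → HasType Γ (Tm.inl t) (Ty.sum σ τ)
  | inr {Γ : List Ty} {σ τ : Ty} {t : Tm} :
      σ.Valid → HasType Γ t τ → HasType Γ (Tm.inr t) (Ty.sum σ τ)
  | caseOf {Γ : List Ty} {σ₁ σ₂ τ : Ty} {t t₁ t₂ : Tm} :
      HasType Γ t (Ty.sum σ₁ σ₂) → HasType (σ₁ :: Γ) t₁ τ → HasType (σ₂ :: Γ) t₂ τ →
      HasType Γ (Tm.caseOf t t₁ t₂) τ
  | ite {Γ : List Ty} {τ : Ty} {t t₁ t₂ : Tm} :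
      HasType Γ t Ty.bool → HasType Γ t₁ τ → HasType Γ t₂ τ → HasType Γ (Tm.ite t t₁ t₂) τ
  | seq {Γ : List Ty} {τ : Ty} {t u : Tm} :
      HasType Γ t Ty.unit → HasType Γ u τ → HasType Γ (Tm.seq t u) τ
  | fold {Γ : List Ty} {τ : Ty} {t : Tm} :
      (Ty.mu τ).Valid → HasType Γ t τ.unfolding → HasType Γ (Tm.fold τ t) (Ty.mu τ)
  | unfold {Γ : List Ty} {τ : Ty} {t : Tm} :
      (Ty.mu τ).Valid → HasType Γ t (Ty.mu τ) → HasType Γ (Tm.unfold τ t) τ.unfolding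

/-- Program contexts: terms with exactly one hole, which may lie under binders. -/
inductive Ctx : Type
  | hole : Ctx
  | lam : Ty → Ctx → Ctx
  | appL : Ctx → Tm → Ctx
  | appR : Tm → Ctx → Ctx
  | fst : Ctx → Ctx
  | snd : Ctx → Ctx
  | pairL : Ctx → Tm → Ctx
  | pairR : Tm → Ctx → Ctx
  | inl : Ctx → Ctx
  | inr : Ctx → Ctx
  | case₁ : Ctx → Tm → Tm → Ctx
  | case₂ : Tm → Ctx → Tm → Ctx
  | case₃ : Tm → Tm → Ctx → Ctx
  | ite₁ : Ctx → Tm → Tm → Ctx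
  | ite₂ : Tm → Ctx → Tm → Ctx
  | ite₃ : Tm → Tm → Ctx → Ctx
  | seqL : Ctx → Tm → Ctx
  | seqR : Tm → Ctx → Ctx
  | fold : Ty → Ctx → Ctx
  | unfold : Ty → Ctx → Ctx

namespace Ctx

/-- `C.plug t` is `C[t]`: the hole is replaced by `t`, whose free variables may be captured by the
binders of `C` above the hole. -/
def plug : Ctx → Tm → Tm
  | hole, t => t
  | lam τ C, t => Tm.lam τ (C.plug t)
  | appL C u, t => Tm.app (C.plug t) u
  | appR u C, t => Tm.app u (C.plug t)
  | fst C, t => Tm.fst (C.plug t)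
  | snd C, t => Tm.snd (C.plug t)
  | pairL C u, t => Tm.pair (C.plug t) u
  | pairR u C, t => Tm.pair u (C.plug t)
  | inl C, t => Tm.inl (C.plug t)
  | inr C, t => Tm.inr (C.plug t)
  | case₁ C u w, t => Tm.caseOf (C.plug t) u w
  | case₂ s C w, t => Tm.caseOf s (C.plug t) w
  | case₃ s u C, t => Tm.caseOf s u (C.plug t)
  | ite₁ C u w, t => Tm.ite (C.plug t) u w
  | ite₂ s C w, t => Tm.ite s (C.plug t) w
  | ite₃ s u C, t => Tm.ite s u (C.plug t)
  | seqL C u, t => Tm.seq (C.plug t) u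
  | seqR u C, t => Tm.seq u (C.plug t)
  | fold τ C, t => Tm.fold τ (C.plug t)
  | unfold τ C, t => Tm.unfold τ (C.plug t)

/-- Evaluation contexts, as particular program contexts. -/
inductive IsEval : Ctx → Prop
  | hole : IsEval hole
  | appL {E : Ctx} (t : Tm) : IsEval E → IsEval (appL E t)
  | appR {v : Tm} {E : Ctx} : Value v → IsEval E → IsEval (appR v E)
  | fst {E : Ctx} : IsEval E → IsEval (fst E)
  | snd {E : Ctx} : IsEval E → IsEval (snd E)
  | pairL {E : Ctx} (t : Tm) : IsEval E → IsEval (pairL E t)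
  | pairR {v : Tm} {E : Ctx} : Value v → IsEval E → IsEval (pairR v E)
  | inl {E : Ctx} : IsEval E → IsEval (inl E)
  | inr {E : Ctx} : IsEval E → IsEval (inr E)
  | case₁ {E : Ctx} (t₁ t₂ : Tm) : IsEval E → IsEval (case₁ E t₁ t₂)
  | ite₁ {E : Ctx} (t₁ t₂ : Tm) : IsEval E → IsEval (ite₁ E t₁ t₂)
  | seqL {E : Ctx} (t : Tm) : IsEval E → IsEval (seqL E t)
  | fold {E : Ctx} (τ : Ty) : IsEval E → IsEval (fold τ E)
  | unfold {E : Ctx} (τ : Ty) : IsEval E → IsEval (unfold τ E)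

/-- `HasType C Γ τ Γ' τ'` is the judgement `⊢ C : Γ, τ → Γ', τ'`: the hole has type `τ` in the
environment `Γ`, and the whole has type `τ'` in the environment `Γ'`. -/
inductive HasType : Ctx → List Ty → Ty → List Ty → Ty → Prop
  | hole {Γ : List Ty} {τ : Ty} : HasType hole Γ τ Γ τ
  | lam {Γ₀ Γ : List Ty} {τ₀ σ τ : Ty} {C : Ctx} :
      σ.Valid → HasType C Γ₀ τ₀ (σ :: Γ) τ → HasType (lam σ C) Γ₀ τ₀ Γ (Ty.arrow σ τ)
  | appL {Γ₀ Γ : List Ty} {τ₀ σ τ : Ty} {C : Ctx} {u : Tm} :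
      HasType C Γ₀ τ₀ Γ (Ty.arrow σ τ) → IsoLang.HasType Γ u σ → HasType (appL C u) Γ₀ τ₀ Γ τ
  | appR {Γ₀ Γ : List Ty} {τ₀ σ τ : Ty} {C : Ctx} {u : Tm} :
      IsoLang.HasType Γ u (Ty.arrow σ τ) → HasType C Γ₀ τ₀ Γ σ → HasType (appR u C) Γ₀ τ₀ Γ τ
  | fst {Γ₀ Γ : List Ty} {τ₀ σ τ : Ty} {C : Ctx} :
      HasType C Γ₀ τ₀ Γ (Ty.prod σ τ) → HasType (fst C) Γ₀ τ₀ Γ σ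
  | snd {Γ₀ Γ : List Ty} {τ₀ σ τ : Ty} {C : Ctx} :
      HasType C Γ₀ τ₀ Γ (Ty.prod σ τ) → HasType (snd C) Γ₀ τ₀ Γ τ
  | pairL {Γ₀ Γ : List Ty} {τ₀ σ τ : Ty} {C : Ctx} {u : Tm} :
      HasType C Γ₀ τ₀ Γ σ → IsoLang.HasType Γ u τ → HasType (pairL C u) Γ₀ τ₀ Γ (Ty.prod σ τ)
  | pairR {Γ₀ Γ : List Ty} {τ₀ σ τ : Ty} {C : Ctx} {u : Tm} :
      IsoLang.HasType Γ u σ → HasType C Γ₀ τ₀ Γ τ → HasType (pairR u C) Γ₀ τ₀ Γ (Ty.prod σ τ)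
  | inl {Γ₀ Γ : List Ty} {τ₀ σ τ : Ty} {C : Ctx} :
      τ.Valid → HasType C Γ₀ τ₀ Γ σ → HasType (inl C) Γ₀ τ₀ Γ (Ty.sum σ τ)
  | inr {Γ₀ Γ : List Ty} {τ₀ σ τ : Ty} {C : Ctx} :
      σ.Valid → HasType C Γ₀ τ₀ Γ τ → HasType (inr C) Γ₀ τ₀ Γ (Ty.sum σ τ)
  | case₁ {Γ₀ Γ : List Ty} {τ₀ σ₁ σ₂ τ : Ty} {C : Ctx} {t₁ t₂ : Tm} :
      HasType C Γ₀ τ₀ Γ (Ty.sum σ₁ σ₂) → IsoLang.HasType (σ₁ :: Γ) t₁ τ →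
      IsoLang.HasType (σ₂ :: Γ) t₂ τ → HasType (case₁ C t₁ t₂) Γ₀ τ₀ Γ τ
  | case₂ {Γ₀ Γ : List Ty} {τ₀ σ₁ σ₂ τ : Ty} {C : Ctx} {t t₂ : Tm} :
      IsoLang.HasType Γ t (Ty.sum σ₁ σ₂) → HasType C Γ₀ τ₀ (σ₁ :: Γ) τ →
      IsoLang.HasType (σ₂ :: Γ) t₂ τ → HasType (case₂ t C t₂) Γ₀ τ₀ Γ τ
  | case₃ {Γ₀ Γ : List Ty} {τ₀ σ₁ σ₂ τ : Ty} {C : Ctx} {t t₁ : Tm} :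
      IsoLang.HasType Γ t (Ty.sum σ₁ σ₂) → IsoLang.HasType (σ₁ :: Γ) t₁ τ →
      HasType C Γ₀ τ₀ (σ₂ :: Γ) τ → HasType (case₃ t t₁ C) Γ₀ τ₀ Γ τ
  | ite₁ {Γ₀ Γ : List Ty} {τ₀ τ : Ty} {C : Ctx} {t₁ t₂ : Tm} :
      HasType C Γ₀ τ₀ Γ Ty.bool → IsoLang.HasType Γ t₁ τ → IsoLang.HasType Γ t₂ τ →
      HasType (ite₁ C t₁ t₂) Γ₀ τ₀ Γ τ
  | ite₂ {Γ₀ Γ : List Ty} {τ₀ τ : Ty} {C : Ctx} {t t₂ : Tm} :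
      IsoLang.HasType Γ t Ty.bool → HasType C Γ₀ τ₀ Γ τ → IsoLang.HasType Γ t₂ τ →
      HasType (ite₂ t C t₂) Γ₀ τ₀ Γ τ
  | ite₃ {Γ₀ Γ : List Ty} {τ₀ τ : Ty} {C : Ctx} {t t₁ : Tm} :
      IsoLang.HasType Γ t Ty.bool → IsoLang.HasType Γ t₁ τ → HasType C Γ₀ τ₀ Γ τ →
      HasType (ite₃ t t₁ C) Γ₀ τ₀ Γ τ
  | seqL {Γ₀ Γ : List Ty} {τ₀ τ : Ty} {C : Ctx} {u : Tm} :
      HasType C Γ₀ τ₀ Γ Ty.unit → IsoLang.HasType Γ u τ → HasType (seqL C u) Γ₀ τ₀ Γ τ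
  | seqR {Γ₀ Γ : List Ty} {τ₀ τ : Ty} {C : Ctx} {u : Tm} :
      IsoLang.HasType Γ u Ty.unit → HasType C Γ₀ τ₀ Γ τ → HasType (seqR u C) Γ₀ τ₀ Γ τ
  | fold {Γ₀ Γ : List Ty} {τ₀ τ : Ty} {C : Ctx} :
      (Ty.mu τ).Valid → HasType C Γ₀ τ₀ Γ τ.unfolding → HasType (fold τ C) Γ₀ τ₀ Γ (Ty.mu τ)
  | unfold {Γ₀ Γ : List Ty} {τ₀ τ : Ty} {C : Ctx} :
      (Ty.mu τ).Valid → HasType C Γ₀ τ₀ Γ (Ty.mu τ) → HasType (unfold τ C) Γ₀ τ₀ Γ τ.unfolding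

end Ctx

/-- Primitive reduction. -/
inductive Prim : Tm → Tm → Prop
  | beta {τ : Ty} {t v : Tm} : Value v → Prim (Tm.app (Tm.lam τ t) v) (t.subst0 v)
  | fst {v w : Tm} : Value v → Value w → Prim (Tm.fst (Tm.pair v w)) v
  | snd {v w : Tm} : Value v → Value w → Prim (Tm.snd (Tm.pair v w)) w
  | seq {t : Tm} : Prim (Tm.seq Tm.unit t) t
  | caseInl {v t₁ t₂ : Tm} : Value v → Prim (Tm.caseOf (Tm.inl v) t₁ t₂) (t₁.subst0 v)
  | caseInr {v t₁ t₂ : Tm} : Value v → Prim (Tm.caseOf (Tm.inr v) t₁ t₂) (t₂.subst0 v)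
  | iteTrue {t₁ t₂ : Tm} : Prim (Tm.ite Tm.tt t₁ t₂) t₁
  | iteFalse {t₁ t₂ : Tm} : Prim (Tm.ite Tm.ff t₁ t₂) t₂
  | unfoldFold {τ : Ty} {v : Tm} : Value v → Prim (Tm.unfold τ (Tm.fold τ v)) v

/-- Reduction: a primitive reduction inside an evaluation context. -/
inductive Red : Tm → Tm → Prop
  | ctx {E : Ctx} {t t' : Tm} : E.IsEval → Prim t t' → Red (E.plug t) (E.plug t')

/-- `TerminatesIn t n v`: the term `t` reduces to the value `v` in `n` steps. -/
inductive TerminatesIn : Tm → ℕ → Tm → Prop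
  | value {v : Tm} : Value v → TerminatesIn v 0 v
  | step {t t' v : Tm} {n : ℕ} : Red t t' → TerminatesIn t' n v → TerminatesIn t (n + 1) v

/-- The term `t` terminates. -/
def Terminates (t : Tm) : Prop := ∃ (n : ℕ) (v : Tm), TerminatesIn t n v

/-- Contextual equivalence `Γ ⊢ t₁ ≃ t₂ : τ`: both terms have type `τ` in `Γ`, and every program
context for that type and environment that yields a closed program of some type `τ'` terminates
with the one if and only if it terminates with the other. -/
def CtxEquiv (Γ : List Ty) (t₁ t₂ : Tm) (τ : Ty) : Prop :=
  HasType Γ t₁ τ ∧ HasType Γ t₂ τ ∧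
    ∀ (C : Ctx) (τ' : Ty), C.HasType Γ τ [] τ' →
      (Terminates (C.plug t₁) ↔ Terminates (C.plug t₂))

end IsoLang

/-- The compiler on types is the inclusion of the types without recursion. -/
def compileTy : FixLang.Ty → IsoLang.Ty
  | .unit => .unit
  | .bool => .bool
  | .arrow σ τ => .arrow (compileTy σ) (compileTy τ)
  | .prod σ τ => .prod (compileTy σ) (compileTy τ)
  | .sum σ τ => .sum (compileTy σ) (compileTy τ)

/-- The body `α → (τ₁ → τ₂)` of the recursive type `μ α. α → (τ₁ → τ₂)`, for closed types
`τ₁` and `τ₂`. -/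
def selfBody (τ₁ τ₂ : IsoLang.Ty) : IsoLang.Ty :=
  .arrow (.var 0) (.arrow τ₁ τ₂)

/-- `λ x : μ α. α → (τ₁ → τ₂). f (λ y : τ₁. ((unfold x) x) y)`, with `f` the free variable of
index `0`. -/
def zHalf (τ₁ τ₂ : IsoLang.Ty) : IsoLang.Tm :=
  .lam (.mu (selfBody τ₁ τ₂))
    (.app (.var 1)
      (.lam τ₁ (.app (.app (.unfold (selfBody τ₁ τ₂) (.var 1)) (.var 1)) (.var 0))))

/-- The Z-combinator `λ f : (τ₁ → τ₂) → τ₁ → τ₂. Z' (fold Z')`, where `Z'` is `zHalf`. -/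
def zComb (τ₁ τ₂ : IsoLang.Ty) : IsoLang.Tm :=
  .lam (.arrow (.arrow τ₁ τ₂) (.arrow τ₁ τ₂))
    (.app (zHalf τ₁ τ₂) (.fold (selfBody τ₁ τ₂) (zHalf τ₁ τ₂)))

/-- The canonical compiler on terms. -/
def compile : FixLang.Tm → IsoLang.Tm
  | .unit => .unit
  | .tt => .tt
  | .ff => .ff
  | .var i => .var i
  | .lam τ t => .lam (compileTy τ) (compile t)
  | .app t u => .app (compile t) (compile u)
  | .fst t => .fst (compile t)
  | .snd t => .snd (compile t)
  | .pair t u => .pair (compile t) (compile u)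
  | .inl t => .inl (compile t)
  | .inr t => .inr (compile t)
  | .caseOf t u w => .caseOf (compile t) (compile u) (compile w)
  | .ite t u w => .ite (compile t) (compile u) (compile w)
  | .seq t u => .seq (compile t) (compile u)
  | .fix τ₁ τ₂ t => .app (zComb (compileTy τ₁) (compileTy τ₂)) (compile t)

/-! Source equivalence follows from target equivalence because the compiler extends to contexts and
a closed program terminates exactly when its compilation does (`terminates_compile_iff`). Source
typing is recovered by erasing recursive types (`hasType_of_compile`).

The converse is the hard direction: a context of `IsoLang` may use recursive types, for which
`FixLang` has no counterpart. But a terminating run is a finite derivation, of some weight `n`, so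
it is enough to imitate the context up to weight `n`. This is an approximate back-translation:
`backTy` unfolds recursive types finitely often and adds a summand for an unknown value, and
unfolding an unknown value diverges. Fold and unfold shift the level of approximation by one, and
`levelCast` shifts it back.

Correctness does not use a logical relation. The relation `Approx` is generated syntactically: it is
a congruence, extended by level conversions, by unknown values at index `0`, and by the pairing of
`fix` with the whole Z-combinator, so that the recursive type inside a compiled `fix` never has to
be approximated. It is closed under substitution and is a simulation both ways. By
`Approx.complete`, an evaluation of the target term whose weight is at most the index is matched by
the source term. By `Approx.sound`, every evaluation of the source term is matched by the target
term, whatever the index, because missing information only causes divergence. Both are strong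
inductions on the weight of a big-step derivation, with `eval_levelCast` for the conversions.

If a context `C` terminates on `compile t₁` with weight `n`, then `exists_approx_ctx` gives one
source context `D` that approximates `C` with index `n`. Completeness makes `D` terminate on `t₁`,
equivalence makes it terminate on `t₂`, and soundness makes `C` terminate on `compile t₂`. -/

/-! ### Substitution and big-step evaluation in `FixLang`. -/

theorem liftRen_comp (ρ ρ' : ℕ → ℕ) : liftRen ρ' ∘ liftRen ρ = liftRen (ρ' ∘ ρ) := by
  funext i; cases i <;> rfl

namespace FixLang

namespace Tm

theorem rename_rename (t : Tm) (ρ ρ' : ℕ → ℕ) :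
    (t.rename ρ).rename ρ' = t.rename (ρ' ∘ ρ) := by
  induction t generalizing ρ ρ' <;> simp_all [rename, liftRen_comp]

theorem liftSub_comp_liftRen (θ : ℕ → Tm) (ρ : ℕ → ℕ) :
    liftSub θ ∘ liftRen ρ = liftSub (θ ∘ ρ) := by
  funext i; cases i <;> rfl

theorem subst_rename (t : Tm) (ρ : ℕ → ℕ) (θ : ℕ → Tm) :
    (t.rename ρ).subst θ = t.subst (θ ∘ ρ) := by
  induction t generalizing ρ θ <;> simp_all [rename, subst, liftSub_comp_liftRen]

theorem rename_liftSub (θ : ℕ → Tm) (ρ : ℕ → ℕ) :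
    (fun i => (liftSub θ i).rename (liftRen ρ)) = liftSub (fun i => (θ i).rename ρ) := by
  funext i
  cases i with
  | zero => rfl
  | succ i => simp only [liftSub, rename_rename]; rfl

theorem rename_subst (t : Tm) (θ : ℕ → Tm) (ρ : ℕ → ℕ) :
    (t.subst θ).rename ρ = t.subst (fun i => (θ i).rename ρ) := by
  induction t generalizing ρ θ <;> simp_all [rename, subst, rename_liftSub]

theorem liftSub_var : liftSub var = var := by
  funext i; cases i <;> rfl

theorem subst_var (t : Tm) : t.subst var = t := by
  induction t <;> simp_all [subst, liftSub_var]

theorem rename_succ_rename (t : Tm) (ρ : ℕ → ℕ) :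
    (t.rename Nat.succ).rename (liftRen ρ) = (t.rename ρ).rename Nat.succ := by
  simp only [rename_rename]; rfl

theorem rename_succ_subst (t : Tm) (θ : ℕ → Tm) :
    (t.rename Nat.succ).subst (liftSub θ) = (t.subst θ).rename Nat.succ := by
  simp only [subst_rename, rename_subst]; rfl

theorem rename_succ_subst_single (t u : Tm) : (t.rename Nat.succ).subst (single u) = t := by
  rw [subst_rename]; exact subst_var t

end Tm

theorem Value.rename {v : Tm} (h : Value v) (ρ : ℕ → ℕ) : Value (v.rename ρ) := by
  induction h <;> constructor <;> assumption

theorem Value.subst {v : Tm} (h : Value v) (θ : ℕ → Tm) : Value (v.subst θ) := by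
  induction h <;> constructor <;> assumption

/-- The function bound to the recursive variable when `fix` is unrolled. -/
abbrev recVal (τ₁ τ₂ : Ty) (f : Tm) : Tm :=
  .lam τ₁ (.app (.fix τ₁ τ₂ (f.rename Nat.succ)) (.var 0))

/-- Big-step evaluation: `Eval t n v` says that `t` evaluates to `v` by a derivation of weight
`n`. -/
inductive Eval : Tm → ℕ → Tm → Prop
  | unit : Eval .unit 0 .unit
  | tt : Eval .tt 0 .tt
  | ff : Eval .ff 0 .ff
  | lam {σ : Ty} {t : Tm} : Eval (.lam σ t) 0 (.lam σ t)
  | app {t u b v w : Tm} {σ : Ty} {i j l : ℕ} :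
      Eval t i (.lam σ b) → Eval u j v → Eval (b.subst0 v) l w →
      Eval (.app t u) (i + j + l + 1) w
  | fst {t v w : Tm} {i : ℕ} : Eval t i (.pair v w) → Eval (.fst t) (i + 1) v
  | snd {t v w : Tm} {i : ℕ} : Eval t i (.pair v w) → Eval (.snd t) (i + 1) w
  | pair {t u v w : Tm} {i j : ℕ} :
      Eval t i v → Eval u j w → Eval (.pair t u) (i + j + 1) (.pair v w)
  | inl {t v : Tm} {i : ℕ} : Eval t i v → Eval (.inl t) (i + 1) (.inl v)
  | inr {t v : Tm} {i : ℕ} : Eval t i v → Eval (.inr t) (i + 1) (.inr v)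
  | caseInl {t t₁ t₂ v w : Tm} {i j : ℕ} :
      Eval t i (.inl v) → Eval (t₁.subst0 v) j w → Eval (.caseOf t t₁ t₂) (i + j + 1) w
  | caseInr {t t₁ t₂ v w : Tm} {i j : ℕ} :
      Eval t i (.inr v) → Eval (t₂.subst0 v) j w → Eval (.caseOf t t₁ t₂) (i + j + 1) w
  | iteTrue {t t₁ t₂ w : Tm} {i j : ℕ} :
      Eval t i .tt → Eval t₁ j w → Eval (.ite t t₁ t₂) (i + j + 1) w
  | iteFalse {t t₁ t₂ w : Tm} {i j : ℕ} :
      Eval t i .ff → Eval t₂ j w → Eval (.ite t t₁ t₂) (i + j + 1) w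
  | seq {t u w : Tm} {i j : ℕ} :
      Eval t i .unit → Eval u j w → Eval (.seq t u) (i + j + 1) w
  | fix {τ₁ τ₂ : Ty} {t b w : Tm} {i j : ℕ} :
      Eval t i (.lam (.arrow τ₁ τ₂) b) →
      Eval (b.subst0 (recVal τ₁ τ₂ (.lam (.arrow τ₁ τ₂) b))) j w →
      -- The weight leaves room for `Approx.sound` to replace the second premise by an application
      -- of the function to `recVal`, of weight `j + 1`, and still be strictly below the conclusion.
      Eval (.fix τ₁ τ₂ t) (i + j + 2) w

theorem Eval.value {t v : Tm} {n : ℕ} (h : Eval t n v) : Value v := by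
  induction h with
  | fst _ ih => cases ih; assumption
  | snd _ ih => cases ih; assumption
  | _ => first | assumption | constructor <;> assumption

theorem Value.eval {v : Tm} (h : Value v) : ∃ n, Eval v n v := by
  induction h with
  | unit => exact ⟨_, .unit⟩
  | tt => exact ⟨_, .tt⟩
  | ff => exact ⟨_, .ff⟩
  | lam => exact ⟨_, .lam⟩
  | pair _ _ ih₁ ih₂ =>
    obtain ⟨_, h₁⟩ := ih₁; obtain ⟨_, h₂⟩ := ih₂; exact ⟨_, .pair h₁ h₂⟩
  | inl _ ih => obtain ⟨_, h⟩ := ih; exact ⟨_, .inl h⟩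
  | inr _ ih => obtain ⟨_, h⟩ := ih; exact ⟨_, .inr h⟩

theorem Eval.deterministic {t v w : Tm} {m n : ℕ} (h : Eval t m v) (h' : Eval t n w) : v = w := by
  induction h generalizing n w with
  | unit => cases h'; rfl
  | tt => cases h'; rfl
  | ff => cases h'; rfl
  | lam => cases h'; rfl
  | app _ _ _ ih₁ ih₂ ih₃ =>
    cases h' with
    | app a b c => cases ih₁ a; cases ih₂ b; exact ih₃ c
  | fst _ ih => cases h' with | fst a => cases ih a; rfl
  | snd _ ih => cases h' with | snd a => cases ih a; rfl
  | pair _ _ ih₁ ih₂ => cases h' with | pair a b => cases ih₁ a; cases ih₂ b; rfl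
  | inl _ ih => cases h' with | inl a => cases ih a; rfl
  | inr _ ih => cases h' with | inr a => cases ih a; rfl
  | caseInl _ _ ih₁ ih₂ =>
    cases h' with
    | caseInl a b => cases ih₁ a; exact ih₂ b
    | caseInr a b => cases ih₁ a
  | caseInr _ _ ih₁ ih₂ =>
    cases h' with
    | caseInl a b => cases ih₁ a
    | caseInr a b => cases ih₁ a; exact ih₂ b
  | iteTrue _ _ ih₁ ih₂ =>
    cases h' with
    | iteTrue a b => exact ih₂ b
    | iteFalse a b => cases ih₁ a
  | iteFalse _ _ ih₁ ih₂ =>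
    cases h' with
    | iteTrue a b => cases ih₁ a
    | iteFalse a b => exact ih₂ b
  | seq _ _ _ ih => cases h' with | seq a b => exact ih b
  | fix _ _ ih₁ ih₂ => cases h' with | fix a b => cases ih₁ a; exact ih₂ b

theorem Eval.eq_of_value {v w : Tm} {n : ℕ} (hv : Value v) (h : Eval v n w) : w = v :=
  have ⟨_, h'⟩ := hv.eval
  h.deterministic h'

theorem Prim.eval {t t' v : Tm} {n : ℕ} (h : Prim t t') (h' : Eval t' n v) :
    ∃ m, Eval t m v := by
  cases h with
  | beta hv => obtain ⟨_, a⟩ := hv.eval; exact ⟨_, .app .lam a h'⟩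
  | fst hv hw =>
    obtain ⟨_, a⟩ := hv.eval; obtain ⟨_, b⟩ := hw.eval
    cases h'.eq_of_value hv; exact ⟨_, .fst (.pair a b)⟩
  | snd hv hw =>
    obtain ⟨_, a⟩ := hv.eval; obtain ⟨_, b⟩ := hw.eval
    cases h'.eq_of_value hw; exact ⟨_, .snd (.pair a b)⟩
  | seq => exact ⟨_, .seq .unit h'⟩
  | caseInl hv => obtain ⟨_, a⟩ := hv.eval; exact ⟨_, .caseInl (.inl a) h'⟩
  | caseInr hv => obtain ⟨_, a⟩ := hv.eval; exact ⟨_, .caseInr (.inr a) h'⟩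
  | iteTrue => exact ⟨_, .iteTrue .tt h'⟩
  | iteFalse => exact ⟨_, .iteFalse .ff h'⟩
  | fix => exact ⟨_, .fix .lam h'⟩

/-- The hole of an evaluation context is a position that every big-step rule for the surrounding
constructor evaluates, so only the premise for that position has to be replaced. -/
theorem Ctx.IsEval.eval_plug {E : Ctx} (hE : E.IsEval) {t t' v : Tm} {n : ℕ} (h : Prim t t')
    (h' : Eval (E.plug t') n v) : ∃ m, Eval (E.plug t) m v := by
  induction hE generalizing n v with
  | hole => exact h.eval h'
  | appL u _ ih =>
    cases h' with | app a b c => obtain ⟨_, a⟩ := ih a; exact ⟨_, .app a b c⟩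
  | appR _ _ ih =>
    cases h' with | app a b c => obtain ⟨_, b⟩ := ih b; exact ⟨_, .app a b c⟩
  | fst _ ih => cases h' with | fst a => obtain ⟨_, a⟩ := ih a; exact ⟨_, .fst a⟩
  | snd _ ih => cases h' with | snd a => obtain ⟨_, a⟩ := ih a; exact ⟨_, .snd a⟩
  | pairL u _ ih => cases h' with | pair a b => obtain ⟨_, a⟩ := ih a; exact ⟨_, .pair a b⟩
  | pairR _ _ ih => cases h' with | pair a b => obtain ⟨_, b⟩ := ih b; exact ⟨_, .pair a b⟩
  | inl _ ih => cases h' with | inl a => obtain ⟨_, a⟩ := ih a; exact ⟨_, .inl a⟩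
  | inr _ ih => cases h' with | inr a => obtain ⟨_, a⟩ := ih a; exact ⟨_, .inr a⟩
  | case₁ u w _ ih =>
    cases h' with
    | caseInl a b => obtain ⟨_, a⟩ := ih a; exact ⟨_, .caseInl a b⟩
    | caseInr a b => obtain ⟨_, a⟩ := ih a; exact ⟨_, .caseInr a b⟩
  | ite₁ u w _ ih =>
    cases h' with
    | iteTrue a b => obtain ⟨_, a⟩ := ih a; exact ⟨_, .iteTrue a b⟩
    | iteFalse a b => obtain ⟨_, a⟩ := ih a; exact ⟨_, .iteFalse a b⟩
  | seqL u _ ih => cases h' with | seq a b => obtain ⟨_, a⟩ := ih a; exact ⟨_, .seq a b⟩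
  | fix σ τ _ ih => cases h' with | fix a b => obtain ⟨_, a⟩ := ih a; exact ⟨_, .fix a b⟩

theorem Prim.red {t t' : Tm} (h : Prim t t') : Red t t' := Red.ctx .hole h

/-- Reduction in any number of steps. -/
abbrev Reds : Tm → Tm → Prop := Relation.ReflTransGen Red

/-- Reduction under one layer `F` of an evaluation context. -/
theorem Reds.frame {t t' : Tm} (h : Reds t t') (F : Ctx → Ctx)
    (hF : ∀ {E : Ctx}, E.IsEval → (F E).IsEval)
    (hp : ∀ E t, (F E).plug t = (F .hole).plug (E.plug t) := by exact fun _ _ => rfl) :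
    Reds ((F .hole).plug t) ((F .hole).plug t') :=
  h.lift _ fun _ _ ⟨hE, hP⟩ => by
    change Red _ _; rw [← hp, ← hp]; exact .ctx (hF hE) hP

theorem Eval.reds {t v : Tm} {n : ℕ} (h : Eval t n v) : Reds t v := by
  induction h with
  | unit | tt | ff | lam => exact .refl
  | app a b _ ih₁ ih₂ ih₃ =>
    exact ((ih₁.frame (.appL · _) (.appL _)).trans (ih₂.frame (.appR _) (.appR a.value))).trans
      (ih₃.head (Prim.beta b.value).red)
  | fst a ih =>
    cases a.value with | pair hv hw => exact (ih.frame .fst .fst).tail (Prim.fst hv hw).red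
  | snd a ih =>
    cases a.value with | pair hv hw => exact (ih.frame .snd .snd).tail (Prim.snd hv hw).red
  | pair a _ ih₁ ih₂ =>
    exact (ih₁.frame (.pairL · _) (.pairL _)).trans (ih₂.frame (.pairR _) (.pairR a.value))
  | inl _ ih => exact ih.frame .inl .inl
  | inr _ ih => exact ih.frame .inr .inr
  | caseInl a _ ih₁ ih₂ =>
    cases a.value with
    | inl hv => exact (ih₁.frame (.case₁ · _ _) (.case₁ _ _)).trans (ih₂.head (Prim.caseInl hv).red)
  | caseInr a _ ih₁ ih₂ =>
    cases a.value with
    | inr hv => exact (ih₁.frame (.case₁ · _ _) (.case₁ _ _)).trans (ih₂.head (Prim.caseInr hv).red)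
  | iteTrue _ _ ih₁ ih₂ =>
    exact (ih₁.frame (.ite₁ · _ _) (.ite₁ _ _)).trans (ih₂.head Prim.iteTrue.red)
  | iteFalse _ _ ih₁ ih₂ =>
    exact (ih₁.frame (.ite₁ · _ _) (.ite₁ _ _)).trans (ih₂.head Prim.iteFalse.red)
  | seq _ _ ih₁ ih₂ => exact (ih₁.frame (.seqL · _) (.seqL _)).trans (ih₂.head Prim.seq.red)
  | fix _ _ ih₁ ih₂ => exact (ih₁.frame (.fix _ _) (.fix _ _)).trans (ih₂.head Prim.fix.red)

/-- Later inductions need a measure that splits along subterms. The weight of a big-step derivation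
does so, and only the existence of an evaluation matters here, so weights need not agree with step
counts. -/
theorem terminates_iff_eval {t : Tm} : Terminates t ↔ ∃ n v, Eval t n v := by
  constructor
  · rintro ⟨n, v, h⟩
    induction h with
    | value hv => obtain ⟨m, h⟩ := hv.eval; exact ⟨m, _, h⟩
    | step hr _ ih =>
      obtain ⟨m, v, h⟩ := ih
      obtain ⟨hE, hP⟩ := hr
      obtain ⟨m, h⟩ := hE.eval_plug hP h
      exact ⟨m, v, h⟩
  · rintro ⟨n, v, h⟩
    have hv := h.value
    have hr := h.reds
    clear h
    induction hr using Relation.ReflTransGen.head_induction_on with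
    | refl => exact ⟨0, v, .value hv⟩
    | head hr _ ih =>
      obtain ⟨m, v, h⟩ := ih
      exact ⟨m + 1, v, .step hr h⟩

end FixLang

/-! ### Substitution and big-step evaluation in `IsoLang`. -/

namespace IsoLang

namespace Tm

theorem rename_rename (t : Tm) (ρ ρ' : ℕ → ℕ) :
    (t.rename ρ).rename ρ' = t.rename (ρ' ∘ ρ) := by
  induction t generalizing ρ ρ' <;> simp_all [rename, liftRen_comp]

theorem liftSub_comp_liftRen (θ : ℕ → Tm) (ρ : ℕ → ℕ) :
    liftSub θ ∘ liftRen ρ = liftSub (θ ∘ ρ) := by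
  funext i; cases i <;> rfl

theorem subst_rename (t : Tm) (ρ : ℕ → ℕ) (θ : ℕ → Tm) :
    (t.rename ρ).subst θ = t.subst (θ ∘ ρ) := by
  induction t generalizing ρ θ <;> simp_all [rename, subst, liftSub_comp_liftRen]

theorem rename_liftSub (θ : ℕ → Tm) (ρ : ℕ → ℕ) :
    (fun i => (liftSub θ i).rename (liftRen ρ)) = liftSub (fun i => (θ i).rename ρ) := by
  funext i
  cases i with
  | zero => rfl
  | succ i => simp only [liftSub, rename_rename]; rfl

theorem rename_subst (t : Tm) (θ : ℕ → Tm) (ρ : ℕ → ℕ) :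
    (t.subst θ).rename ρ = t.subst (fun i => (θ i).rename ρ) := by
  induction t generalizing ρ θ <;> simp_all [rename, subst, rename_liftSub]

theorem liftSub_var : liftSub var = var := by
  funext i; cases i <;> rfl

theorem subst_var (t : Tm) : t.subst var = t := by
  induction t <;> simp_all [subst, liftSub_var]

theorem rename_succ_rename (t : Tm) (ρ : ℕ → ℕ) :
    (t.rename Nat.succ).rename (liftRen ρ) = (t.rename ρ).rename Nat.succ := by
  simp only [rename_rename]; rfl

theorem rename_succ_subst (t : Tm) (θ : ℕ → Tm) :
    (t.rename Nat.succ).subst (liftSub θ) = (t.subst θ).rename Nat.succ := by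
  simp only [subst_rename, rename_subst]; rfl

theorem rename_succ_subst_single (t u : Tm) : (t.rename Nat.succ).subst (single u) = t := by
  rw [subst_rename]; exact subst_var t

end Tm

theorem Value.rename {v : Tm} (h : Value v) (ρ : ℕ → ℕ) : Value (v.rename ρ) := by
  induction h <;> constructor <;> assumption

theorem Value.subst {v : Tm} (h : Value v) (θ : ℕ → Tm) : Value (v.subst θ) := by
  induction h <;> constructor <;> assumption

/-- Big-step evaluation: `Eval t n v` says that `t` evaluates to `v` by a derivation of weight
`n`. -/
inductive Eval : Tm → ℕ → Tm → Prop
  | unit : Eval .unit 0 .unit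
  | tt : Eval .tt 0 .tt
  | ff : Eval .ff 0 .ff
  | lam {σ : Ty} {t : Tm} : Eval (.lam σ t) 0 (.lam σ t)
  | app {t u b v w : Tm} {σ : Ty} {i j l : ℕ} :
      Eval t i (.lam σ b) → Eval u j v → Eval (b.subst0 v) l w →
      Eval (.app t u) (i + j + l + 1) w
  | fst {t v w : Tm} {i : ℕ} : Eval t i (.pair v w) → Eval (.fst t) (i + 1) v
  | snd {t v w : Tm} {i : ℕ} : Eval t i (.pair v w) → Eval (.snd t) (i + 1) w
  | pair {t u v w : Tm} {i j : ℕ} :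
      Eval t i v → Eval u j w → Eval (.pair t u) (i + j + 1) (.pair v w)
  | inl {t v : Tm} {i : ℕ} : Eval t i v → Eval (.inl t) (i + 1) (.inl v)
  | inr {t v : Tm} {i : ℕ} : Eval t i v → Eval (.inr t) (i + 1) (.inr v)
  | caseInl {t t₁ t₂ v w : Tm} {i j : ℕ} :
      Eval t i (.inl v) → Eval (t₁.subst0 v) j w → Eval (.caseOf t t₁ t₂) (i + j + 1) w
  | caseInr {t t₁ t₂ v w : Tm} {i j : ℕ} :
      Eval t i (.inr v) → Eval (t₂.subst0 v) j w → Eval (.caseOf t t₁ t₂) (i + j + 1) w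
  | iteTrue {t t₁ t₂ w : Tm} {i j : ℕ} :
      Eval t i .tt → Eval t₁ j w → Eval (.ite t t₁ t₂) (i + j + 1) w
  | iteFalse {t t₁ t₂ w : Tm} {i j : ℕ} :
      Eval t i .ff → Eval t₂ j w → Eval (.ite t t₁ t₂) (i + j + 1) w
  | seq {t u w : Tm} {i j : ℕ} :
      Eval t i .unit → Eval u j w → Eval (.seq t u) (i + j + 1) w
  | fold {τ : Ty} {t v : Tm} {i : ℕ} : Eval t i v → Eval (.fold τ t) (i + 1) (.fold τ v)
  | unfold {τ : Ty} {t v : Tm} {i : ℕ} : Eval t i (.fold τ v) → Eval (.unfold τ t) (i + 1) v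

theorem Eval.value {t v : Tm} {n : ℕ} (h : Eval t n v) : Value v := by
  induction h with
  | fst _ ih => cases ih; assumption
  | snd _ ih => cases ih; assumption
  | unfold _ ih => cases ih; assumption
  | _ => first | assumption | constructor <;> assumption

theorem Value.eval {v : Tm} (h : Value v) : ∃ n, Eval v n v := by
  induction h with
  | unit => exact ⟨_, .unit⟩
  | tt => exact ⟨_, .tt⟩
  | ff => exact ⟨_, .ff⟩
  | lam => exact ⟨_, .lam⟩
  | pair _ _ ih₁ ih₂ =>
    obtain ⟨_, h₁⟩ := ih₁; obtain ⟨_, h₂⟩ := ih₂; exact ⟨_, .pair h₁ h₂⟩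
  | inl _ ih => obtain ⟨_, h⟩ := ih; exact ⟨_, .inl h⟩
  | inr _ ih => obtain ⟨_, h⟩ := ih; exact ⟨_, .inr h⟩
  | fold _ ih => obtain ⟨_, h⟩ := ih; exact ⟨_, .fold h⟩

theorem Eval.deterministic {t v w : Tm} {m n : ℕ} (h : Eval t m v) (h' : Eval t n w) : v = w := by
  induction h generalizing n w with
  | unit => cases h'; rfl
  | tt => cases h'; rfl
  | ff => cases h'; rfl
  | lam => cases h'; rfl
  | app _ _ _ ih₁ ih₂ ih₃ =>
    cases h' with
    | app a b c => cases ih₁ a; cases ih₂ b; exact ih₃ c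
  | fst _ ih => cases h' with | fst a => cases ih a; rfl
  | snd _ ih => cases h' with | snd a => cases ih a; rfl
  | pair _ _ ih₁ ih₂ => cases h' with | pair a b => cases ih₁ a; cases ih₂ b; rfl
  | inl _ ih => cases h' with | inl a => cases ih a; rfl
  | inr _ ih => cases h' with | inr a => cases ih a; rfl
  | caseInl _ _ ih₁ ih₂ =>
    cases h' with
    | caseInl a b => cases ih₁ a; exact ih₂ b
    | caseInr a b => cases ih₁ a
  | caseInr _ _ ih₁ ih₂ =>
    cases h' with
    | caseInl a b => cases ih₁ a
    | caseInr a b => cases ih₁ a; exact ih₂ b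
  | iteTrue _ _ ih₁ ih₂ =>
    cases h' with
    | iteTrue a b => exact ih₂ b
    | iteFalse a b => cases ih₁ a
  | iteFalse _ _ ih₁ ih₂ =>
    cases h' with
    | iteTrue a b => cases ih₁ a
    | iteFalse a b => exact ih₂ b
  | seq _ _ _ ih => cases h' with | seq a b => exact ih b
  | fold _ ih => cases h' with | fold a => cases ih a; rfl
  | unfold _ ih => cases h' with | unfold a => cases ih a; rfl

theorem Eval.eq_of_value {v w : Tm} {n : ℕ} (hv : Value v) (h : Eval v n w) : w = v :=
  have ⟨_, h'⟩ := hv.eval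
  h.deterministic h'

theorem Prim.eval {t t' v : Tm} {n : ℕ} (h : Prim t t') (h' : Eval t' n v) :
    ∃ m, Eval t m v := by
  cases h with
  | beta hv => obtain ⟨_, a⟩ := hv.eval; exact ⟨_, .app .lam a h'⟩
  | fst hv hw =>
    obtain ⟨_, a⟩ := hv.eval; obtain ⟨_, b⟩ := hw.eval
    cases h'.eq_of_value hv; exact ⟨_, .fst (.pair a b)⟩
  | snd hv hw =>
    obtain ⟨_, a⟩ := hv.eval; obtain ⟨_, b⟩ := hw.eval
    cases h'.eq_of_value hw; exact ⟨_, .snd (.pair a b)⟩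
  | seq => exact ⟨_, .seq .unit h'⟩
  | caseInl hv => obtain ⟨_, a⟩ := hv.eval; exact ⟨_, .caseInl (.inl a) h'⟩
  | caseInr hv => obtain ⟨_, a⟩ := hv.eval; exact ⟨_, .caseInr (.inr a) h'⟩
  | iteTrue => exact ⟨_, .iteTrue .tt h'⟩
  | iteFalse => exact ⟨_, .iteFalse .ff h'⟩
  | unfoldFold hv =>
    obtain ⟨_, a⟩ := hv.eval
    cases h'.eq_of_value hv; exact ⟨_, .unfold (.fold a)⟩

theorem Ctx.IsEval.eval_plug {E : Ctx} (hE : E.IsEval) {t t' v : Tm} {n : ℕ} (h : Prim t t')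
    (h' : Eval (E.plug t') n v) : ∃ m, Eval (E.plug t) m v := by
  induction hE generalizing n v with
  | hole => exact h.eval h'
  | appL u _ ih =>
    cases h' with | app a b c => obtain ⟨_, a⟩ := ih a; exact ⟨_, .app a b c⟩
  | appR _ _ ih =>
    cases h' with | app a b c => obtain ⟨_, b⟩ := ih b; exact ⟨_, .app a b c⟩
  | fst _ ih => cases h' with | fst a => obtain ⟨_, a⟩ := ih a; exact ⟨_, .fst a⟩
  | snd _ ih => cases h' with | snd a => obtain ⟨_, a⟩ := ih a; exact ⟨_, .snd a⟩
  | pairL u _ ih => cases h' with | pair a b => obtain ⟨_, a⟩ := ih a; exact ⟨_, .pair a b⟩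
  | pairR _ _ ih => cases h' with | pair a b => obtain ⟨_, b⟩ := ih b; exact ⟨_, .pair a b⟩
  | inl _ ih => cases h' with | inl a => obtain ⟨_, a⟩ := ih a; exact ⟨_, .inl a⟩
  | inr _ ih => cases h' with | inr a => obtain ⟨_, a⟩ := ih a; exact ⟨_, .inr a⟩
  | case₁ u w _ ih =>
    cases h' with
    | caseInl a b => obtain ⟨_, a⟩ := ih a; exact ⟨_, .caseInl a b⟩
    | caseInr a b => obtain ⟨_, a⟩ := ih a; exact ⟨_, .caseInr a b⟩
  | ite₁ u w _ ih =>
    cases h' with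
    | iteTrue a b => obtain ⟨_, a⟩ := ih a; exact ⟨_, .iteTrue a b⟩
    | iteFalse a b => obtain ⟨_, a⟩ := ih a; exact ⟨_, .iteFalse a b⟩
  | seqL u _ ih => cases h' with | seq a b => obtain ⟨_, a⟩ := ih a; exact ⟨_, .seq a b⟩
  | fold τ _ ih => cases h' with | fold a => obtain ⟨_, a⟩ := ih a; exact ⟨_, .fold a⟩
  | unfold τ _ ih => cases h' with | unfold a => obtain ⟨_, a⟩ := ih a; exact ⟨_, .unfold a⟩

theorem Prim.red {t t' : Tm} (h : Prim t t') : Red t t' := Red.ctx .hole h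

/-- Reduction in any number of steps. -/
abbrev Reds : Tm → Tm → Prop := Relation.ReflTransGen Red

/-- Reduction under one layer `F` of an evaluation context. -/
theorem Reds.frame {t t' : Tm} (h : Reds t t') (F : Ctx → Ctx)
    (hF : ∀ {E : Ctx}, E.IsEval → (F E).IsEval)
    (hp : ∀ E t, (F E).plug t = (F .hole).plug (E.plug t) := by exact fun _ _ => rfl) :
    Reds ((F .hole).plug t) ((F .hole).plug t') :=
  h.lift _ fun _ _ ⟨hE, hP⟩ => by
    change Red _ _; rw [← hp, ← hp]; exact .ctx (hF hE) hP

theorem Eval.reds {t v : Tm} {n : ℕ} (h : Eval t n v) : Reds t v := by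
  induction h with
  | unit | tt | ff | lam => exact .refl
  | app a b _ ih₁ ih₂ ih₃ =>
    exact ((ih₁.frame (.appL · _) (.appL _)).trans (ih₂.frame (.appR _) (.appR a.value))).trans
      (ih₃.head (Prim.beta b.value).red)
  | fst a ih =>
    cases a.value with | pair hv hw => exact (ih.frame .fst .fst).tail (Prim.fst hv hw).red
  | snd a ih =>
    cases a.value with | pair hv hw => exact (ih.frame .snd .snd).tail (Prim.snd hv hw).red
  | pair a _ ih₁ ih₂ =>
    exact (ih₁.frame (.pairL · _) (.pairL _)).trans (ih₂.frame (.pairR _) (.pairR a.value))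
  | inl _ ih => exact ih.frame .inl .inl
  | inr _ ih => exact ih.frame .inr .inr
  | caseInl a _ ih₁ ih₂ =>
    cases a.value with
    | inl hv => exact (ih₁.frame (.case₁ · _ _) (.case₁ _ _)).trans (ih₂.head (Prim.caseInl hv).red)
  | caseInr a _ ih₁ ih₂ =>
    cases a.value with
    | inr hv => exact (ih₁.frame (.case₁ · _ _) (.case₁ _ _)).trans (ih₂.head (Prim.caseInr hv).red)
  | iteTrue _ _ ih₁ ih₂ =>
    exact (ih₁.frame (.ite₁ · _ _) (.ite₁ _ _)).trans (ih₂.head Prim.iteTrue.red)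
  | iteFalse _ _ ih₁ ih₂ =>
    exact (ih₁.frame (.ite₁ · _ _) (.ite₁ _ _)).trans (ih₂.head Prim.iteFalse.red)
  | seq _ _ ih₁ ih₂ => exact (ih₁.frame (.seqL · _) (.seqL _)).trans (ih₂.head Prim.seq.red)
  | fold _ ih => exact ih.frame (.fold _) (.fold _)
  | unfold a ih =>
    cases a.value with
    | fold hv => exact (ih.frame (.unfold _) (.unfold _)).tail (Prim.unfoldFold hv).red

theorem terminates_iff_eval {t : Tm} : Terminates t ↔ ∃ n v, Eval t n v := by
  constructor
  · rintro ⟨n, v, h⟩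
    induction h with
    | value hv => obtain ⟨m, h⟩ := hv.eval; exact ⟨m, _, h⟩
    | step hr _ ih =>
      obtain ⟨m, v, h⟩ := ih
      obtain ⟨hE, hP⟩ := hr
      obtain ⟨m, h⟩ := hE.eval_plug hP h
      exact ⟨m, v, h⟩
  · rintro ⟨n, v, h⟩
    have hv := h.value
    have hr := h.reds
    clear h
    induction hr using Relation.ReflTransGen.head_induction_on with
    | refl => exact ⟨0, v, .value hv⟩
    | head hr _ ih =>
      obtain ⟨m, v, h⟩ := ih
      exact ⟨m + 1, v, .step hr h⟩

end IsoLang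

/-! ### Finite approximations of recursive types and conversions between levels. -/

/-- Interpretation of the types of `IsoLang` in `FixLang`, given one for recursive types as a
function of their bodies. Type variables, which do not occur in closed types, become `unit`. -/
def backTyWith (g : IsoLang.Ty → FixLang.Ty) : IsoLang.Ty → FixLang.Ty
  | .unit => .unit
  | .bool => .bool
  | .arrow σ τ => .arrow (backTyWith g σ) (backTyWith g τ)
  | .prod σ τ => .prod (backTyWith g σ) (backTyWith g τ)
  | .sum σ τ => .sum (backTyWith g σ) (backTyWith g τ)
  | .mu τ => g τ
  | .var _ => .unit

/-- The approximation at level `m` of the types of `IsoLang` by types of `FixLang`: a recursive type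
is unfolded `m` times, with a summand `unit` for a value that is not known. -/
def backTy : ℕ → IsoLang.Ty → FixLang.Ty
  | 0 => backTyWith fun _ => .unit
  | m + 1 => backTyWith fun τ => .sum (backTy m τ.unfolding) .unit

section backTy

variable (m : ℕ) (σ τ : IsoLang.Ty)

@[simp] theorem backTy_unit : backTy m .unit = .unit := by cases m <;> rfl
@[simp] theorem backTy_bool : backTy m .bool = .bool := by cases m <;> rfl
@[simp] theorem backTy_var (i : ℕ) : backTy m (.var i) = .unit := by cases m <;> rfl
@[simp] theorem backTy_arrow : backTy m (.arrow σ τ) = .arrow (backTy m σ) (backTy m τ) := by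
  cases m <;> rfl
@[simp] theorem backTy_prod : backTy m (.prod σ τ) = .prod (backTy m σ) (backTy m τ) := by
  cases m <;> rfl
@[simp] theorem backTy_sum : backTy m (.sum σ τ) = .sum (backTy m σ) (backTy m τ) := by
  cases m <;> rfl
-- Types without recursion are represented exactly at every level, so back-translated contexts have
-- a hole of the original source type.
@[simp] theorem backTy_compileTy (τ : FixLang.Ty) : backTy m (compileTy τ) = τ := by
  induction τ <;> simp_all [compileTy]

end backTy

/-- The value of a recursive type at a given level of approximation that carries no
information. -/
def unknown : ℕ → FixLang.Tm
  | 0 => .unit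
  | _ + 1 => .inr .unit

/-- The conversion from approximation level `a` to approximation level `b` at a type. -/
def levelCast (a b : ℕ) (τ : IsoLang.Ty) : FixLang.Tm :=
  match a, b, τ with
  | _, _, .unit => .lam .unit (.var 0)
  | _, _, .bool => .lam .bool (.var 0)
  | _, _, .var _ => .lam .unit (.var 0)
  | a, b, .arrow σ τ =>
    .lam (backTy a (.arrow σ τ)) (.lam (backTy b σ)
      (.app (levelCast a b τ) (.app (.var 1) (.app (levelCast b a σ) (.var 0)))))
  | a, b, .prod σ τ =>
    .lam (backTy a (.prod σ τ))
      (.pair (.app (levelCast a b σ) (.fst (.var 0))) (.app (levelCast a b τ) (.snd (.var 0))))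
  | a, b, .sum σ τ =>
    .lam (backTy a (.sum σ τ)) (.caseOf (.var 0)
      (.inl (.app (levelCast a b σ) (.var 0))) (.inr (.app (levelCast a b τ) (.var 0))))
  -- Level `0` stores nothing about a recursive type: conversion from it yields the unknown value,
  -- and conversion to it forgets the argument.
  | 0, b, .mu _ => .lam .unit (unknown b)
  | a + 1, 0, .mu τ => .lam (backTy (a + 1) (.mu τ)) .unit
  | a + 1, b + 1, .mu τ =>
    .lam (backTy (a + 1) (.mu τ)) (.caseOf (.var 0)
      (.inl (.app (levelCast a b τ.unfolding) (.var 0))) (.inr (.var 0)))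
  -- Contravariance exchanges the two levels, hence their sum. Unfolding may enlarge the type, but
  -- there both levels drop.
  termination_by (a + b, sizeOf τ)
  decreasing_by all_goals simp_wf; omega

/-- A function value `f` converted from level `a` to level `b`. -/
abbrev castFun (a b : ℕ) (σ τ : IsoLang.Ty) (f : FixLang.Tm) : FixLang.Tm :=
  .lam (backTy b σ)
    (.app (levelCast a b τ) (.app (f.rename Nat.succ) (.app (levelCast b a σ) (.var 0))))

/-- A divergent term of `FixLang`. -/
def diverge (τ : FixLang.Ty) : FixLang.Tm :=
  .app (.fix .unit τ (.lam (.arrow .unit τ) (.var 0))) .unit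

@[simp] theorem rename_unknown (m : ℕ) (ρ : ℕ → ℕ) : (unknown m).rename ρ = unknown m := by
  cases m <;> rfl

@[simp] theorem subst_unknown (m : ℕ) (θ : ℕ → FixLang.Tm) : (unknown m).subst θ = unknown m := by
  cases m <;> rfl

theorem value_unknown (m : ℕ) : FixLang.Value (unknown m) := by
  cases m <;> repeat constructor

@[simp] theorem rename_levelCast (a b : ℕ) (τ : IsoLang.Ty) (ρ : ℕ → ℕ) :
    (levelCast a b τ).rename ρ = levelCast a b τ := by
  induction a, b, τ using levelCast.induct generalizing ρ <;>
    simp_all [levelCast, FixLang.Tm.rename, liftRen]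

@[simp] theorem subst_levelCast (a b : ℕ) (τ : IsoLang.Ty) (θ : ℕ → FixLang.Tm) :
    (levelCast a b τ).subst θ = levelCast a b τ := by
  induction a, b, τ using levelCast.induct generalizing θ <;>
    simp_all [levelCast, FixLang.Tm.subst, FixLang.Tm.liftSub, FixLang.Tm.rename]

theorem hasType_unknown (m : ℕ) (τ : IsoLang.Ty) (Γ : List FixLang.Ty) :
    FixLang.HasType Γ (unknown m) (backTy m (.mu τ)) := by
  cases m
  · exact .unit
  · exact .inr .unit

theorem hasType_diverge (τ : FixLang.Ty) (Γ : List FixLang.Ty) :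
    FixLang.HasType Γ (diverge τ) τ :=
  .app (.fix (.lam (.var rfl))) .unit

theorem hasType_levelCast (a b : ℕ) (τ : IsoLang.Ty) (Γ : List FixLang.Ty) :
    FixLang.HasType Γ (levelCast a b τ) (.arrow (backTy a τ) (backTy b τ)) := by
  induction a, b, τ using levelCast.induct generalizing Γ with
  | case1 | case2 | case3 =>
    rw [levelCast]; simp only [backTy_unit, backTy_bool, backTy_var]
    exact .lam (.var rfl)
  | case4 a b σ τ ih₁ ih₂ =>
    rw [levelCast]; simp only [backTy_arrow]
    exact .lam (.lam (.app (ih₁ _) (.app (.var rfl) (.app (ih₂ _) (.var rfl)))))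
  | case5 a b σ τ ih₁ ih₂ =>
    rw [levelCast]; simp only [backTy_prod]
    exact .lam (.pair (.app (ih₁ _) (.fst (.var rfl))) (.app (ih₂ _) (.snd (.var rfl))))
  | case6 a b σ τ ih₁ ih₂ =>
    rw [levelCast]; simp only [backTy_sum]
    exact .lam (.caseOf (.var rfl) (.inl (.app (ih₁ _) (.var rfl)))
      (.inr (.app (ih₂ _) (.var rfl))))
  | case7 b τ => rw [levelCast]; exact .lam (hasType_unknown _ _ _)
  | case8 a τ => rw [levelCast]; exact .lam .unit
  | case9 a b τ ih =>
    rw [levelCast]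
    exact .lam (.caseOf (.var rfl) (.inl (.app (ih _) (.var rfl))) (.inr (.var rfl)))

/-- One unrolling and one beta step lead back to the same term, so any derivation contains a
strictly lighter one of the same kind. -/
theorem eval_diverge (τ : FixLang.Ty) (n : ℕ) (v : FixLang.Tm) :
    ¬ FixLang.Eval (diverge τ) n v := by
  induction n using Nat.strong_induction_on generalizing v with
  | _ n ih =>
    intro h
    cases h with
    | app h₁ h₂ h₃ =>
      cases h₁ with
      | fix h₁ h₄ =>
        cases h₁
        cases h₄
        cases h₂
        exact ih _ (by omega) _ h₃

/-! ### Instances of the Z-combinator and the approximation relation. -/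

/-- The instance of `zHalf` at a function `f`. -/
abbrev zInst (τ₁ τ₂ : IsoLang.Ty) (f : IsoLang.Tm) : IsoLang.Tm :=
  .lam (.mu (selfBody τ₁ τ₂))
    (.app (f.rename Nat.succ)
      (.lam τ₁ (.app (.app (.unfold (selfBody τ₁ τ₂) (.var 1)) (.var 1)) (.var 0))))

/-- The function to which the Z-combinator applies its argument `f`. -/
abbrev zVal (τ₁ τ₂ : IsoLang.Ty) (f : IsoLang.Tm) : IsoLang.Tm :=
  .lam τ₁ (.app (.app
    (.unfold (selfBody τ₁ τ₂) (.fold (selfBody τ₁ τ₂) ((zInst τ₁ τ₂ f).rename Nat.succ)))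
    (.fold (selfBody τ₁ τ₂) ((zInst τ₁ τ₂ f).rename Nat.succ))) (.var 0))

theorem rename_zVal (τ₁ τ₂ : IsoLang.Ty) (f : IsoLang.Tm) (ρ : ℕ → ℕ) :
    (zVal τ₁ τ₂ f).rename ρ = zVal τ₁ τ₂ (f.rename ρ) := by
  simp [IsoLang.Tm.rename, IsoLang.Tm.rename_succ_rename, liftRen]

theorem subst_zVal (τ₁ τ₂ : IsoLang.Ty) (f : IsoLang.Tm) (θ : ℕ → IsoLang.Tm) :
    (zVal τ₁ τ₂ f).subst θ = zVal τ₁ τ₂ (f.subst θ) := by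
  simp [IsoLang.Tm.rename, IsoLang.Tm.subst, IsoLang.Tm.rename_succ_subst,
    IsoLang.Tm.rename_succ_rename, liftRen, IsoLang.Tm.liftSub]

/-- `Approx k Γ m τ s t` says that the term `s` of `FixLang`, at level `m`, approximates the term
`t` of type `τ` of `IsoLang` well enough for `k` steps of evaluation of `t`. The environment `Γ` records
a level and a type for every variable. -/
inductive Approx : ℕ → List (ℕ × IsoLang.Ty) → ℕ → IsoLang.Ty → FixLang.Tm → IsoLang.Tm → Prop
  | var {k Γ m i τ} : Γ[i]? = some (m, τ) → Approx k Γ m τ (.var i) (.var i)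
  | unit {k Γ m} : Approx k Γ m .unit .unit .unit
  | tt {k Γ m} : Approx k Γ m .bool .tt .tt
  | ff {k Γ m} : Approx k Γ m .bool .ff .ff
  -- The source annotation is fixed because `fix` unrolls only a function with the matching
  -- annotation. The target annotation plays no role in evaluation and is left free.
  | lam {k Γ m σ τ s t ρ} :
      Approx k ((m, σ) :: Γ) m τ s t →
      Approx k Γ m (.arrow σ τ) (.lam (backTy m σ) s) (.lam ρ t)
  | app {k Γ m σ τ s₁ s₂ t₁ t₂} :
      Approx k Γ m (.arrow σ τ) s₁ t₁ → Approx k Γ m σ s₂ t₂ →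
      Approx k Γ m τ (.app s₁ s₂) (.app t₁ t₂)
  | fst {k Γ m σ τ s t} : Approx k Γ m (.prod σ τ) s t → Approx k Γ m σ (.fst s) (.fst t)
  | snd {k Γ m σ τ s t} : Approx k Γ m (.prod σ τ) s t → Approx k Γ m τ (.snd s) (.snd t)
  | pair {k Γ m σ τ s₁ s₂ t₁ t₂} :
      Approx k Γ m σ s₁ t₁ → Approx k Γ m τ s₂ t₂ →
      Approx k Γ m (.prod σ τ) (.pair s₁ s₂) (.pair t₁ t₂)
  | inl {k Γ m σ τ s t} : Approx k Γ m σ s t → Approx k Γ m (.sum σ τ) (.inl s) (.inl t)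
  | inr {k Γ m σ τ s t} : Approx k Γ m τ s t → Approx k Γ m (.sum σ τ) (.inr s) (.inr t)
  | caseOf {k Γ m σ₁ σ₂ τ s s₁ s₂ t t₁ t₂} :
      Approx k Γ m (.sum σ₁ σ₂) s t → Approx k ((m, σ₁) :: Γ) m τ s₁ t₁ →
      Approx k ((m, σ₂) :: Γ) m τ s₂ t₂ →
      Approx k Γ m τ (.caseOf s s₁ s₂) (.caseOf t t₁ t₂)
  | ite {k Γ m τ s s₁ s₂ t t₁ t₂} :
      Approx k Γ m .bool s t → Approx k Γ m τ s₁ t₁ → Approx k Γ m τ s₂ t₂ →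
      Approx k Γ m τ (.ite s s₁ s₂) (.ite t t₁ t₂)
  | seq {k Γ m τ s₁ s₂ t₁ t₂} :
      Approx k Γ m .unit s₁ t₁ → Approx k Γ m τ s₂ t₂ →
      Approx k Γ m τ (.seq s₁ s₂) (.seq t₁ t₂)
  -- The Z-combinator is matched as a single block, so its recursive type needs no level.
  | fix {k Γ m τ₁ τ₂ ρ₁ ρ₂ s t} :
      Approx k Γ m (.arrow (.arrow τ₁ τ₂) (.arrow τ₁ τ₂)) s t →
      Approx k Γ m (.arrow τ₁ τ₂) (.fix (backTy m τ₁) (backTy m τ₂) s) (.app (zComb ρ₁ ρ₂) t)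
  -- The contents are reached only after an unfold has been paid for, so one unit less of precision
  -- is enough. They sit one level lower, as in `backTy`.
  | fold {k Γ m τ s t} :
      Approx (k - 1) Γ m τ.unfolding s t → Approx k Γ (m + 1) (.mu τ) (.inl s) (.fold τ t)
  -- The branch for an unknown value diverges: it may lose terminations but never creates one.
  | unfold {k Γ m τ υ s t} :
      υ = τ.unfolding → Approx k Γ (m + 1) (.mu τ) s t →
      Approx k Γ m υ (.caseOf s (.var 0) (diverge (backTy m υ))) (.unfold τ t)
  -- Conversion leaves the target term alone. It is harmless while the index exceeds neither level,
  -- as the information it drops lies too deep to be observed.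
  | cast {k Γ a b τ s t} :
      k ≤ a → k ≤ b → Approx k Γ a τ s t → Approx k Γ b τ (.app (levelCast a b τ) s) t
  -- The value to which a converted function evaluates. As a constructor of its own it keeps the
  -- relation closed under evaluation.
  | castFun {k Γ a b σ τ f t} :
      k ≤ a → k ≤ b → FixLang.Value f → IsoLang.Value t → Approx k Γ a (.arrow σ τ) f t →
      Approx k Γ b (.arrow σ τ) (castFun a b σ τ f) t
  -- Only exhausted precision permits replacing an arbitrary value by one without information. The
  -- target must be a value, since the source is one and soundness has to evaluate the target.
  | unknown {Γ m τ t} : IsoLang.Value t → Approx 0 Γ m (.mu τ) (unknown m) t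
  -- These are the eta-expanded recursive calls passed to the functional by `fix` and by the
  -- Z-combinator.
  | recVal {k Γ m τ₁ τ₂ ρ₁ ρ₂ f f'} :
      FixLang.Value f → IsoLang.Value f' →
      Approx k Γ m (.arrow (.arrow τ₁ τ₂) (.arrow τ₁ τ₂)) f f' →
      Approx k Γ m (.arrow τ₁ τ₂) (FixLang.recVal (backTy m τ₁) (backTy m τ₂) f) (zVal ρ₁ ρ₂ f')

namespace Approx

theorem mono {k k' Γ m τ s t} (h : Approx k Γ m τ s t) (hk : k' ≤ k) : Approx k' Γ m τ s t := by
  induction h generalizing k' with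
  | var h => exact .var h
  | unit => exact .unit
  | tt => exact .tt
  | ff => exact .ff
  | lam _ ih => exact .lam (ih hk)
  | app _ _ ih₁ ih₂ => exact .app (ih₁ hk) (ih₂ hk)
  | fst _ ih => exact .fst (ih hk)
  | snd _ ih => exact .snd (ih hk)
  | pair _ _ ih₁ ih₂ => exact .pair (ih₁ hk) (ih₂ hk)
  | inl _ ih => exact .inl (ih hk)
  | inr _ ih => exact .inr (ih hk)
  | caseOf _ _ _ ih ih₁ ih₂ => exact .caseOf (ih hk) (ih₁ hk) (ih₂ hk)
  | ite _ _ _ ih ih₁ ih₂ => exact .ite (ih hk) (ih₁ hk) (ih₂ hk)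
  | seq _ _ ih₁ ih₂ => exact .seq (ih₁ hk) (ih₂ hk)
  | fix _ ih => exact .fix (ih hk)
  | fold _ ih => exact .fold (ih (by omega))
  | unfold hυ _ ih => exact .unfold hυ (ih hk)
  | cast ha hb _ ih => exact .cast (hk.trans ha) (hk.trans hb) (ih hk)
  | castFun ha hb hf ht _ ih => exact .castFun (hk.trans ha) (hk.trans hb) hf ht (ih hk)
  | unknown ht => cases Nat.le_zero.1 hk; exact .unknown ht
  | recVal hf hf' _ ih => exact .recVal hf hf' (ih hk)

theorem rename {k Γ Δ m τ s t} {ρ : ℕ → ℕ} (h : Approx k Γ m τ s t)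
    (hρ : ∀ i x, Γ[i]? = some x → Δ[ρ i]? = some x) :
    Approx k Δ m τ (s.rename ρ) (t.rename ρ) := by
  have lift : ∀ {Γ Δ : List (ℕ × IsoLang.Ty)} {ρ : ℕ → ℕ} (y : ℕ × IsoLang.Ty),
      (∀ i x, Γ[i]? = some x → Δ[ρ i]? = some x) →
      ∀ i x, (y :: Γ)[i]? = some x → (y :: Δ)[liftRen ρ i]? = some x := by
    intro Γ Δ ρ y h i x hx
    cases i with
    | zero => exact hx
    | succ i => exact h i x hx
  induction h generalizing Δ ρ with
  | var h => exact .var (hρ _ _ h)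
  | unit => exact .unit
  | tt => exact .tt
  | ff => exact .ff
  | lam _ ih => exact .lam (ih (lift _ hρ))
  | app _ _ ih₁ ih₂ => exact .app (ih₁ hρ) (ih₂ hρ)
  | fst _ ih => exact .fst (ih hρ)
  | snd _ ih => exact .snd (ih hρ)
  | pair _ _ ih₁ ih₂ => exact .pair (ih₁ hρ) (ih₂ hρ)
  | inl _ ih => exact .inl (ih hρ)
  | inr _ ih => exact .inr (ih hρ)
  | caseOf _ _ _ ih ih₁ ih₂ => exact .caseOf (ih hρ) (ih₁ (lift _ hρ)) (ih₂ (lift _ hρ))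
  | ite _ _ _ ih ih₁ ih₂ => exact .ite (ih hρ) (ih₁ hρ) (ih₂ hρ)
  | seq _ _ ih₁ ih₂ => exact .seq (ih₁ hρ) (ih₂ hρ)
  | fix _ ih => exact .fix (ih hρ)
  | fold _ ih => exact .fold (ih hρ)
  | unfold hυ _ ih => exact .unfold hυ (ih hρ)
  | cast ha hb _ ih =>
    simp only [FixLang.Tm.rename, rename_levelCast]
    exact .cast ha hb (ih hρ)
  | castFun ha hb hf ht _ ih =>
    simp only [FixLang.Tm.rename, rename_levelCast, FixLang.Tm.rename_succ_rename]
    exact .castFun ha hb (hf.rename _) (ht.rename _) (ih hρ)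
  | unknown ht => rw [rename_unknown]; exact .unknown (ht.rename _)
  | recVal hf hf' _ ih =>
    rw [rename_zVal]
    simp only [FixLang.Tm.rename, FixLang.Tm.rename_succ_rename]
    exact .recVal (hf.rename ρ) (hf'.rename ρ) (ih hρ)

theorem subst {k Γ Δ m τ s t} {θ : ℕ → FixLang.Tm} {θ' : ℕ → IsoLang.Tm}
    (h : Approx k Γ m τ s t)
    (hθ : ∀ i n σ, Γ[i]? = some (n, σ) → Approx k Δ n σ (θ i) (θ' i)) :
    Approx k Δ m τ (s.subst θ) (t.subst θ') := by
  have lift : ∀ {k : ℕ} {Γ Δ : List (ℕ × IsoLang.Ty)} {θ : ℕ → FixLang.Tm}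
      {θ' : ℕ → IsoLang.Tm} (y : ℕ × IsoLang.Ty),
      (∀ i n σ, Γ[i]? = some (n, σ) → Approx k Δ n σ (θ i) (θ' i)) →
      ∀ i n σ, (y :: Γ)[i]? = some (n, σ) →
        Approx k (y :: Δ) n σ (FixLang.Tm.liftSub θ i) (IsoLang.Tm.liftSub θ' i) := by
    intro k Γ Δ θ θ' y h i n σ hx
    cases i with
    | zero => exact .var hx
    | succ i => exact (h i n σ hx).rename fun _ _ hx => hx
  induction h generalizing Δ θ θ' with
  | var h => exact hθ _ _ _ h
  | unit => exact .unit
  | tt => exact .tt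
  | ff => exact .ff
  | lam _ ih => exact .lam (ih (lift _ hθ))
  | app _ _ ih₁ ih₂ => exact .app (ih₁ hθ) (ih₂ hθ)
  | fst _ ih => exact .fst (ih hθ)
  | snd _ ih => exact .snd (ih hθ)
  | pair _ _ ih₁ ih₂ => exact .pair (ih₁ hθ) (ih₂ hθ)
  | inl _ ih => exact .inl (ih hθ)
  | inr _ ih => exact .inr (ih hθ)
  | caseOf _ _ _ ih ih₁ ih₂ => exact .caseOf (ih hθ) (ih₁ (lift _ hθ)) (ih₂ (lift _ hθ))
  | ite _ _ _ ih ih₁ ih₂ => exact .ite (ih hθ) (ih₁ hθ) (ih₂ hθ)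
  | seq _ _ ih₁ ih₂ => exact .seq (ih₁ hθ) (ih₂ hθ)
  | fix _ ih => exact .fix (ih hθ)
  -- Under a fold the index is smaller, so the substituted terms are weakened by monotonicity.
  | fold _ ih => exact .fold (ih fun i n σ h => (hθ i n σ h).mono (Nat.sub_le _ _))
  | unfold hυ _ ih => exact .unfold hυ (ih hθ)
  | cast ha hb _ ih =>
    simp only [FixLang.Tm.subst, subst_levelCast]
    exact .cast ha hb (ih hθ)
  | castFun ha hb hf ht _ ih =>
    simp only [FixLang.Tm.subst, subst_levelCast, FixLang.Tm.rename_succ_subst]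
    exact .castFun ha hb (hf.subst _) (ht.subst _) (ih hθ)
  | unknown ht => rw [subst_unknown]; exact .unknown (ht.subst _)
  | recVal hf hf' _ ih =>
    rw [subst_zVal]
    simp only [FixLang.Tm.subst, FixLang.Tm.rename_succ_subst]
    exact .recVal (hf.subst θ) (hf'.subst θ') (ih hθ)

theorem subst0 {k m n σ τ s t v w} (h : Approx k [(n, σ)] m τ s t) (hv : Approx k [] n σ v w) :
    Approx k [] m τ (s.subst0 v) (t.subst0 w) := by
  refine h.subst fun i n σ hi => ?_
  match i with
  | 0 => cases hi; exact hv

end Approx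

/-! ### Composing evaluations of applications, and unrolling the Z-combinator. -/

namespace FixLang

theorem Eval.app_congr_left {t g u w : Tm} {m n : ℕ} (h : Eval t m g) (h' : Eval (.app g u) n w) :
    ∃ l, Eval (.app t u) l w := by
  cases h' with
  | app a b c => cases a.eq_of_value h.value; exact ⟨_, .app h b c⟩

theorem Eval.app_congr_right {f t g w : Tm} {m n : ℕ} (h : Eval t m g)
    (h' : Eval (.app f g) n w) : ∃ l, Eval (.app f t) l w := by
  cases h' with
  | app a b c => cases b.eq_of_value h.value; exact ⟨_, .app a h c⟩

theorem Value.eval_beta {σ : Ty} {b u w : Tm} {n : ℕ} (hu : Value u)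
    (h : Eval (b.subst0 u) n w) : ∃ l, Eval (.app (.lam σ b) u) l w :=
  have ⟨_, h'⟩ := hu.eval
  ⟨_, .app .lam h' h⟩

theorem Value.exists_eval_beta {σ : Ty} {b u : Tm} {P : Tm → Prop} (hu : Value u)
    (h : ∃ n w, Eval (b.subst0 u) n w ∧ P w) : ∃ n w, Eval (.app (.lam σ b) u) n w ∧ P w :=
  have ⟨_, w, e, hw⟩ := h
  have ⟨_, e'⟩ := hu.eval_beta e
  ⟨_, w, e', hw⟩

/-- The simulations produce an evaluation of the functional applied to its recursive value. This
turns it into an unrolling of `fix`. -/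
theorem Eval.fix_of_app {τ₁ τ₂ : Ty} {t b w : Tm} {m n : ℕ}
    (h : Eval t m (.lam (.arrow τ₁ τ₂) b))
    (h' : Eval (.app (.lam (.arrow τ₁ τ₂) b) (recVal τ₁ τ₂ (.lam (.arrow τ₁ τ₂) b))) n w) :
    ∃ l, Eval (.fix τ₁ τ₂ t) l w := by
  cases h' with
  | app a b c => cases a; cases b; exact ⟨_, .fix h c⟩

end FixLang

namespace IsoLang

theorem Eval.app_congr_left {t g u w : Tm} {m n : ℕ} (h : Eval t m g) (h' : Eval (.app g u) n w) :
    ∃ l, Eval (.app t u) l w := by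
  cases h' with
  | app a b c => cases a.eq_of_value h.value; exact ⟨_, .app h b c⟩

theorem Eval.app_congr_right {f t g w : Tm} {m n : ℕ} (h : Eval t m g)
    (h' : Eval (.app f g) n w) : ∃ l, Eval (.app f t) l w := by
  cases h' with
  | app a b c => cases b.eq_of_value h.value; exact ⟨_, .app a h c⟩

theorem Value.eval_beta {σ : Ty} {b u w : Tm} {n : ℕ} (hu : Value u)
    (h : Eval (b.subst0 u) n w) : ∃ l, Eval (.app (.lam σ b) u) l w :=
  have ⟨_, h'⟩ := hu.eval
  ⟨_, .app .lam h' h⟩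

end IsoLang

section zComb

open IsoLang

variable {τ₁ τ₂ : Ty} {f v : Tm} {n : ℕ}

theorem zInst_body_subst0 :
    (Tm.app (f.rename Nat.succ) (.lam τ₁ (.app (.app (.unfold (selfBody τ₁ τ₂) (.var 1))
      (.var 1)) (.var 0)))).subst0 (.fold (selfBody τ₁ τ₂) (zInst τ₁ τ₂ f)) =
    .app f (zVal τ₁ τ₂ f) := by
  simp only [Tm.subst0, Tm.subst, Tm.rename_succ_subst_single]
  rfl

theorem zComb_body_subst0 :
    (Tm.app (zHalf τ₁ τ₂) (.fold (selfBody τ₁ τ₂) (zHalf τ₁ τ₂))).subst0 f =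
      .app (zInst τ₁ τ₂ f) (.fold (selfBody τ₁ τ₂) (zInst τ₁ τ₂ f)) :=
  rfl

theorem zVal_body_subst0 {u : Tm} :
    (Tm.app (.app
      (.unfold (selfBody τ₁ τ₂) (.fold (selfBody τ₁ τ₂) ((zInst τ₁ τ₂ f).rename Nat.succ)))
      (.fold (selfBody τ₁ τ₂) ((zInst τ₁ τ₂ f).rename Nat.succ))) (.var 0)).subst0 u =
    .app (.app (.unfold (selfBody τ₁ τ₂) (.fold (selfBody τ₁ τ₂) (zInst τ₁ τ₂ f)))
      (.fold (selfBody τ₁ τ₂) (zInst τ₁ τ₂ f))) u := by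
  simp only [Tm.subst0, Tm.subst, Tm.rename_succ_subst_single]
  rfl

theorem eval_zInst_app (h : Eval (.app f (zVal τ₁ τ₂ f)) n v) :
    ∃ m, Eval (.app (zInst τ₁ τ₂ f) (.fold (selfBody τ₁ τ₂) (zInst τ₁ τ₂ f))) m v := by
  rw [← zInst_body_subst0] at h
  exact ⟨_, .app .lam (.fold .lam) h⟩

/-- The strict inequality is what lets the induction on weight continue through the Z-combinator. -/
theorem eval_zInst_app_inv
    (h : Eval (.app (zInst τ₁ τ₂ f) (.fold (selfBody τ₁ τ₂) (zInst τ₁ τ₂ f))) n v) :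
    ∃ m < n, Eval (.app f (zVal τ₁ τ₂ f)) m v := by
  cases h with
  | app a b c =>
    cases a
    cases b with
    | fold b => cases b; rw [zInst_body_subst0] at c; exact ⟨_, by omega, c⟩

theorem eval_zComb {t : Tm} {m : ℕ} (ht : Eval t m f) (h : Eval (.app f (zVal τ₁ τ₂ f)) n v) :
    ∃ l, Eval (.app (zComb τ₁ τ₂) t) l v := by
  obtain ⟨_, h⟩ := eval_zInst_app h
  exact ⟨_, .app .lam ht h⟩

theorem eval_unfold_fold_zInst (h : Eval (.app f (zVal τ₁ τ₂ f)) n v) :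
    ∃ m, Eval (.app (.unfold (selfBody τ₁ τ₂) (.fold (selfBody τ₁ τ₂) (zInst τ₁ τ₂ f)))
      (.fold (selfBody τ₁ τ₂) (zInst τ₁ τ₂ f))) m v := by
  obtain ⟨_, h⟩ := eval_zInst_app h
  exact (Eval.unfold (.fold .lam)).app_congr_left h

theorem eval_unfold_fold_zInst_inv
    (h : Eval (.app (.unfold (selfBody τ₁ τ₂) (.fold (selfBody τ₁ τ₂) (zInst τ₁ τ₂ f)))
      (.fold (selfBody τ₁ τ₂) (zInst τ₁ τ₂ f))) n v) :
    ∃ m < n, Eval (.app f (zVal τ₁ τ₂ f)) m v := by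
  cases h with
  | app a b c =>
    cases a with
    | unfold a =>
      cases a with
      | fold a =>
        cases a
        obtain ⟨m, hm, h⟩ := eval_zInst_app_inv (.app .lam b c)
        exact ⟨m, by omega, h⟩

end zComb

/-! ### Inversion on values and correctness of level conversion. -/

namespace Approx

section inversion

variable {k m : ℕ} {σ τ : IsoLang.Ty} {w : FixLang.Tm} {v : IsoLang.Tm}

theorem inv_unit (h : Approx k [] m .unit w v) (hw : FixLang.Value w) : w = .unit ∧ v = .unit := by
  cases h <;> first | exact ⟨rfl, rfl⟩ | cases hw

theorem inv_bool (h : Approx k [] m .bool w v) (hw : FixLang.Value w) :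
    w = .tt ∧ v = .tt ∨ w = .ff ∧ v = .ff := by
  cases h <;> first | exact .inl ⟨rfl, rfl⟩ | exact .inr ⟨rfl, rfl⟩ | cases hw

/-- It recovers the exact annotation, without which `fix` could not unroll. The body is left open
because the function may be an abstraction, a converted function or a recursive value. -/
theorem inv_arrow (h : Approx k [] m (.arrow σ τ) w v) (hw : FixLang.Value w) :
    ∃ b, w = .lam (backTy m σ) b := by
  cases h <;> first | exact ⟨_, rfl⟩ | cases hw

theorem inv_prod (h : Approx k [] m (.prod σ τ) w v) (hw : FixLang.Value w) :
    ∃ w₁ w₂ v₁ v₂, w = .pair w₁ w₂ ∧ v = .pair v₁ v₂ ∧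
      Approx k [] m σ w₁ v₁ ∧ Approx k [] m τ w₂ v₂ := by
  cases h <;> first | exact ⟨_, _, _, _, rfl, rfl, ‹_›, ‹_›⟩ | cases hw

theorem inv_sum (h : Approx k [] m (.sum σ τ) w v) (hw : FixLang.Value w) :
    (∃ w' v', w = .inl w' ∧ v = .inl v' ∧ Approx k [] m σ w' v') ∨
      ∃ w' v', w = .inr w' ∧ v = .inr v' ∧ Approx k [] m τ w' v' := by
  cases h <;>
    first
    | exact .inl ⟨_, _, rfl, rfl, ‹_›⟩
    | exact .inr ⟨_, _, rfl, rfl, ‹_›⟩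
    | cases hw

/-- With a positive index an unknown value is impossible and the contents of a fold are genuinely
present. -/
theorem inv_mu (h : Approx k [] m (.mu τ) w v) (hw : FixLang.Value w) :
    (k = 0 ∧ w = _root_.unknown m) ∨ ∃ n w' v', m = n + 1 ∧ w = .inl w' ∧ v = .fold τ v' ∧
      Approx (k - 1) [] n τ.unfolding w' v' := by
  cases h <;>
    first
    | exact .inl ⟨rfl, rfl⟩
    | exact .inr ⟨_, _, _, rfl, rfl, rfl, ‹_›⟩
    | cases hw

/-- No value constructor of the relation has a type variable as its type, so conversion at such a
type holds vacuously. -/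
theorem inv_var {i : ℕ} (h : Approx k [] m (.var i) w v) : ¬ FixLang.Value w := by
  intro hw
  cases h <;> cases hw

end inversion

theorem levelCast_app_subst0 {a b : ℕ} {τ : IsoLang.Ty} {u : FixLang.Tm} :
    (FixLang.Tm.app (levelCast a b τ) (.var 0)).subst0 u = .app (levelCast a b τ) u := by
  simp only [FixLang.Tm.subst0, FixLang.Tm.subst, subst_levelCast, FixLang.Tm.single]

/-- Conversion between levels turns approximations by values into approximations by values. -/
theorem eval_levelCast {a b k : ℕ} {τ : IsoLang.Ty} {w : FixLang.Tm} {v : IsoLang.Tm}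
    (h : Approx k [] a τ w v) (hw : FixLang.Value w) (hv : IsoLang.Value v) (ha : k ≤ a)
    (hb : k ≤ b) :
    ∃ n w', FixLang.Eval (.app (levelCast a b τ) w) n w' ∧ Approx k [] b τ w' v := by
  induction a, b, τ using levelCast.induct generalizing k w v with
  | case1 a b =>
    obtain ⟨rfl, rfl⟩ := h.inv_unit hw
    rw [levelCast]
    exact hw.exists_eval_beta ⟨_, _, .unit, .unit⟩
  | case2 a b =>
    rw [levelCast]
    obtain ⟨rfl, rfl⟩ | ⟨rfl, rfl⟩ := h.inv_bool hw
    · exact hw.exists_eval_beta ⟨_, _, .tt, .tt⟩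
    · exact hw.exists_eval_beta ⟨_, _, .ff, .ff⟩
  | case3 a b i => exact absurd hw h.inv_var
  | case4 a b σ τ ih₁ ih₂ =>
    rw [levelCast]
    refine hw.exists_eval_beta ?_
    simp only [FixLang.Tm.subst0, FixLang.Tm.subst, subst_levelCast, FixLang.Tm.liftSub,
      FixLang.Tm.single]
    -- Converting a function only wraps it. Its argument and result are converted when it is called,
    -- which is the business of `complete_app` and `sound_app`.
    exact ⟨_, _, .lam, .castFun ha hb hw hv h⟩
  | case5 a b σ τ ih₁ ih₂ =>
    rw [levelCast]
    refine hw.exists_eval_beta ?_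
    obtain ⟨w₁, w₂, v₁, v₂, rfl, rfl, h₁, h₂⟩ := h.inv_prod hw
    cases hw with | pair hw₁ hw₂ =>
    cases hv with | pair hv₁ hv₂ =>
    obtain ⟨_, u₁, e₁, h₁⟩ := ih₁ h₁ hw₁ hv₁ ha hb
    obtain ⟨_, u₂, e₂, h₂⟩ := ih₂ h₂ hw₂ hv₂ ha hb
    obtain ⟨_, f₁⟩ := hw₁.eval
    obtain ⟨_, f₂⟩ := hw₂.eval
    obtain ⟨_, e₁⟩ := (FixLang.Eval.fst (.pair f₁ f₂)).app_congr_right e₁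
    obtain ⟨_, e₂⟩ := (FixLang.Eval.snd (.pair f₁ f₂)).app_congr_right e₂
    simp only [FixLang.Tm.subst0, FixLang.Tm.subst, subst_levelCast, FixLang.Tm.single]
    exact ⟨_, _, .pair e₁ e₂, .pair h₁ h₂⟩
  | case6 a b σ τ ih₁ ih₂ =>
    rw [levelCast]
    refine hw.exists_eval_beta ?_
    simp only [FixLang.Tm.subst0, FixLang.Tm.subst, subst_levelCast, FixLang.Tm.single,
      FixLang.Tm.liftSub]
    obtain ⟨w', v', rfl, rfl, h'⟩ | ⟨w', v', rfl, rfl, h'⟩ := h.inv_sum hw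
    · cases hw with | inl hw =>
      cases hv with | inl hv =>
      obtain ⟨_, u, e, h⟩ := ih₁ h' hw hv ha hb
      obtain ⟨_, f⟩ := hw.eval
      rw [← levelCast_app_subst0] at e
      exact ⟨_, _, .caseInl (.inl f) (.inl e), .inl h⟩
    · cases hw with | inr hw =>
      cases hv with | inr hv =>
      obtain ⟨_, u, e, h⟩ := ih₂ h' hw hv ha hb
      obtain ⟨_, f⟩ := hw.eval
      rw [← levelCast_app_subst0] at e
      exact ⟨_, _, .caseInr (.inr f) (.inr e), .inr h⟩
  | case7 b τ =>
    rw [levelCast]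
    refine hw.exists_eval_beta ?_
    -- A level of `0` forces the index to be `0`, where the unknown value approximates any value.
    cases Nat.le_zero.1 ha
    obtain ⟨_, e⟩ := (value_unknown b).eval
    rw [FixLang.Tm.subst0, subst_unknown]
    exact ⟨_, _, e, .unknown hv⟩
  | case8 a τ =>
    rw [levelCast]
    cases Nat.le_zero.1 hb
    exact hw.exists_eval_beta ⟨_, _, .unit, .unknown hv⟩
  | case9 a b τ ih =>
    rw [levelCast]
    refine hw.exists_eval_beta ?_
    simp only [FixLang.Tm.subst0, FixLang.Tm.subst, subst_levelCast, FixLang.Tm.single,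
      FixLang.Tm.liftSub]
    obtain ⟨rfl, rfl⟩ | ⟨n, w', v', hn, rfl, rfl, h'⟩ := h.inv_mu hw
    · exact ⟨_, _, .caseInr (.inr .unit) (.inr .unit), .unknown hv⟩
    · cases hn
      cases hw with | inl hw =>
      cases hv with | fold hv =>
      -- Passing under the fold lowers the index and both levels by one. If the index is already
      -- `0`, the bounds hold trivially.
      obtain ⟨_, u, e, h⟩ := ih h' hw hv (by omega) (by omega)
      obtain ⟨_, f⟩ := hw.eval
      rw [← levelCast_app_subst0] at e
      exact ⟨_, _, .caseInl (.inl f) (.inl e), .fold h⟩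

end Approx

/-! ### The two simulations. -/

namespace Approx

/-- If `t` evaluates by a derivation of weight at most `n`, then so does any term that approximates
it well enough. -/
def Complete (n : ℕ) : Prop :=
  ∀ {k m : ℕ} {τ : IsoLang.Ty} {s : FixLang.Tm} {t v : IsoLang.Tm},
    Approx k [] m τ s t → IsoLang.Eval t n v → n ≤ k →
    ∃ j w, FixLang.Eval s j w ∧ Approx (k - n) [] m τ w v

/-- If `s` evaluates by a derivation of weight `n`, then so does any term that it approximates. -/
def Sound (n : ℕ) : Prop :=
  ∀ {m : ℕ} {τ : IsoLang.Ty} {s w : FixLang.Tm} {t : IsoLang.Tm},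
    Approx 0 [] m τ s t → FixLang.Eval s n w → ∃ j v, IsoLang.Eval t j v ∧ Approx 0 [] m τ w v

variable {n k l m : ℕ} {σ τ : IsoLang.Ty}

theorem castFun_body_subst0 {a b : ℕ} {f u : FixLang.Tm} :
    (FixLang.Tm.app (levelCast a b τ) (.app (f.rename Nat.succ)
      (.app (levelCast b a σ) (.var 0)))).subst0 u =
    .app (levelCast a b τ) (.app f (.app (levelCast b a σ) u)) := by
  simp only [FixLang.Tm.subst0, FixLang.Tm.subst, subst_levelCast,
    FixLang.Tm.rename_succ_subst_single, FixLang.Tm.single]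

theorem recVal_body_subst0 {τ₁ τ₂ : FixLang.Ty} {f u : FixLang.Tm} :
    (FixLang.Tm.app (.fix τ₁ τ₂ (f.rename Nat.succ)) (.var 0)).subst0 u =
    .app (.fix τ₁ τ₂ f) u := by
  simp only [FixLang.Tm.subst0, FixLang.Tm.subst, FixLang.Tm.rename_succ_subst_single,
    FixLang.Tm.single]

/-- Wrappers from conversions can be nested around one target function without adding to its weight.
Hence the inner induction on the derivation for the function; the weight decreases only at a real
abstraction or a recursive call. -/
theorem complete_app (ih : ∀ n' < n, Complete n') {f u : FixLang.Tm} {ρ : IsoLang.Ty}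
    {b u' v : IsoLang.Tm} (h : Approx k [] m (.arrow σ τ) f (.lam ρ b)) (hf : FixLang.Value f)
    (hu : Approx k [] m σ u u') (hv : FixLang.Value u) (hv' : IsoLang.Value u')
    (he : IsoLang.Eval (b.subst0 u') l v) (hl : l < n) (hk : l ≤ k) :
    ∃ j w, FixLang.Eval (.app f u) j w ∧ Approx (k - l) [] m τ w v := by
  generalize hΓ : ([] : List (ℕ × IsoLang.Ty)) = Γ at h
  generalize hT : IsoLang.Ty.arrow σ τ = T at h
  generalize ht : IsoLang.Tm.lam ρ b = t at h
  induction h generalizing u with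
  | lam h =>
    subst hΓ; cases hT; cases ht
    obtain ⟨_, w, e, h⟩ := ih l hl (h.subst0 hu) he hk
    obtain ⟨_, e⟩ := hv.eval_beta e
    exact ⟨_, w, e, h⟩
  | @castFun k Γ a c σ₀ τ₀ f t ha hc hf' _ h ih' =>
    subst hΓ; cases hT; subst ht
    obtain ⟨_, u₂, e₂, hu₂⟩ := eval_levelCast hu hv hv' hc ha
    obtain ⟨_, w₃, e₃, h₃⟩ := ih' hf' hu₂ e₂.value hk rfl rfl rfl
    obtain ⟨_, w₄, e₄, h₄⟩ := eval_levelCast (b := c) h₃ e₃.value he.value (by omega) (by omega)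
    obtain ⟨_, e₃⟩ := e₂.app_congr_right e₃
    obtain ⟨_, e₄⟩ := e₃.app_congr_right e₄
    rw [← castFun_body_subst0] at e₄
    obtain ⟨_, e⟩ := hv.eval_beta e₄
    exact ⟨_, w₄, e, h₄⟩
  | @recVal k Γ m τ₁ τ₂ ρ₁ ρ₂ f f' hF hF' h _ =>
    subst hΓ; cases hT; cases ht
    have hr := Approx.recVal (ρ₁ := ρ) (ρ₂ := ρ₂) hF hF' h
    rw [zVal_body_subst0] at he
    cases he with
    | app a b c =>
      cases b.eq_of_value hv'
      -- A recursive call of the target first computes the functional at `zVal` and then applies the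
      -- result. Each half is lighter than `n`, so the induction hypothesis matches the halves
      -- separately and `fix` reassembles them.
      obtain ⟨i, hi, a'⟩ := eval_unfold_fold_zInst_inv a
      obtain ⟨_, g, eg, hg⟩ := ih i (by omega) (h.app hr) a' (by omega)
      obtain ⟨_, w, e, hw⟩ := ih _ (by omega)
        ((hg.mono (Nat.sub_le_sub_left hi.le _)).app (hu.mono (Nat.sub_le _ _)))
        (.app .lam b c) (by omega)
      obtain ⟨b₀, rfl⟩ := h.inv_arrow hF
      rw [backTy_arrow] at eg
      obtain ⟨_, eg⟩ := FixLang.Eval.fix_of_app .lam eg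
      obtain ⟨_, e⟩ := eg.app_congr_left e
      rw [← backTy_arrow, ← recVal_body_subst0] at e
      obtain ⟨_, e⟩ := hv.eval_beta e
      exact ⟨_, w, e, hw.mono (by omega)⟩
  | _ => first | (cases hT; done) | cases hf

/-- The index acts as fuel: each premise of a target derivation spends its own weight, and what
remains is the precision of the resulting value. -/
theorem complete (n : ℕ) : Complete n := by
  induction n using Nat.strong_induction_on with
  | _ n ih =>
  intro k m τ s t v h he hk
  generalize hΓ : ([] : List (ℕ × IsoLang.Ty)) = Γ at h
  -- A conversion keeps the target derivation unchanged, so its case needs a structural hypothesis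
  -- in addition to the one on weights.
  induction h generalizing v with
  | var h => subst hΓ; simp at h
  | unit => cases he; exact ⟨_, _, .unit, .unit⟩
  | tt => cases he; exact ⟨_, _, .tt, .tt⟩
  | ff => cases he; exact ⟨_, _, .ff, .ff⟩
  | lam h => subst hΓ; cases he; exact ⟨_, _, .lam, .lam h⟩
  | app h₁ h₂ =>
    subst hΓ
    cases he with
    | app a b c =>
      obtain ⟨_, f, e₁, h₁⟩ := ih _ (by omega) h₁ a (by omega)
      obtain ⟨_, u, e₂, h₂⟩ := ih _ (by omega) h₂ b (by omega)
      obtain ⟨_, w, e, hw⟩ := complete_app ih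
        (h₁.mono (Nat.sub_le_sub_left (Nat.le_add_right _ _) _)) e₁.value
        (h₂.mono (Nat.sub_le_sub_left (Nat.le_add_left _ _) _)) e₂.value b.value c
        (by omega) (by omega)
      obtain ⟨_, e⟩ := e₂.app_congr_right e
      obtain ⟨_, e⟩ := e₁.app_congr_left e
      exact ⟨_, w, e, hw.mono (by omega)⟩
  | fst h =>
    subst hΓ
    cases he with
    | fst a =>
      obtain ⟨_, _, e, h⟩ := ih _ (by omega) h a (by omega)
      obtain ⟨_, _, _, _, rfl, hv, h, -⟩ := h.inv_prod e.value
      cases hv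
      exact ⟨_, _, .fst e, h.mono (by omega)⟩
  | snd h =>
    subst hΓ
    cases he with
    | snd a =>
      obtain ⟨_, _, e, h⟩ := ih _ (by omega) h a (by omega)
      obtain ⟨_, _, _, _, rfl, hv, -, h⟩ := h.inv_prod e.value
      cases hv
      exact ⟨_, _, .snd e, h.mono (by omega)⟩
  | pair h₁ h₂ =>
    subst hΓ
    cases he with
    | pair a b =>
      obtain ⟨_, _, e₁, h₁⟩ := ih _ (by omega) h₁ a (by omega)
      obtain ⟨_, _, e₂, h₂⟩ := ih _ (by omega) h₂ b (by omega)
      exact ⟨_, _, .pair e₁ e₂, .pair (h₁.mono (by omega)) (h₂.mono (by omega))⟩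
  | inl h =>
    subst hΓ
    cases he with
    | inl a =>
      obtain ⟨_, _, e, h⟩ := ih _ (by omega) h a (by omega)
      exact ⟨_, _, .inl e, .inl (h.mono (by omega))⟩
  | inr h =>
    subst hΓ
    cases he with
    | inr a =>
      obtain ⟨_, _, e, h⟩ := ih _ (by omega) h a (by omega)
      exact ⟨_, _, .inr e, .inr (h.mono (by omega))⟩
  | caseOf h h₁ h₂ =>
    subst hΓ
    cases he with
    | @caseInl _ _ _ _ _ i _ a b =>
      obtain ⟨_, _, e, h⟩ := ih _ (by omega) h a (by omega)
      obtain ⟨_, _, rfl, hv, h⟩ | ⟨_, _, -, hv, -⟩ := h.inv_sum e.value <;> cases hv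
      obtain ⟨_, _, e', h'⟩ := ih _ (by omega) ((h₁.mono (Nat.sub_le _ i)).subst0 h) b (by omega)
      exact ⟨_, _, .caseInl e e', h'.mono (by omega)⟩
    | @caseInr _ _ _ _ _ i _ a b =>
      obtain ⟨_, _, e, h⟩ := ih _ (by omega) h a (by omega)
      obtain ⟨_, _, -, hv, -⟩ | ⟨_, _, rfl, hv, h⟩ := h.inv_sum e.value <;> cases hv
      obtain ⟨_, _, e', h'⟩ := ih _ (by omega) ((h₂.mono (Nat.sub_le _ i)).subst0 h) b (by omega)
      exact ⟨_, _, .caseInr e e', h'.mono (by omega)⟩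
  | ite h h₁ h₂ =>
    subst hΓ
    cases he with
    | iteTrue a b =>
      obtain ⟨_, _, e, h⟩ := ih _ (by omega) h a (by omega)
      obtain ⟨rfl, hv⟩ | ⟨-, hv⟩ := h.inv_bool e.value <;> cases hv
      obtain ⟨_, _, e', h'⟩ := ih _ (by omega) h₁ b (by omega)
      exact ⟨_, _, .iteTrue e e', h'.mono (by omega)⟩
    | iteFalse a b =>
      obtain ⟨_, _, e, h⟩ := ih _ (by omega) h a (by omega)
      obtain ⟨-, hv⟩ | ⟨rfl, hv⟩ := h.inv_bool e.value <;> cases hv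
      obtain ⟨_, _, e', h'⟩ := ih _ (by omega) h₂ b (by omega)
      exact ⟨_, _, .iteFalse e e', h'.mono (by omega)⟩
  | seq h₁ h₂ =>
    subst hΓ
    cases he with
    | seq a b =>
      obtain ⟨_, _, e, h⟩ := ih _ (by omega) h₁ a (by omega)
      obtain ⟨rfl, -⟩ := h.inv_unit e.value
      obtain ⟨_, _, e', h'⟩ := ih _ (by omega) h₂ b (by omega)
      exact ⟨_, _, .seq e e', h'.mono (by omega)⟩
  | fix h =>
    subst hΓ
    cases he with
    | app a b c =>
      cases a
      rw [zComb_body_subst0] at c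
      obtain ⟨i, hi, c⟩ := eval_zInst_app_inv c
      obtain ⟨_, f, e, h⟩ := ih _ (by omega) h b (by omega)
      obtain ⟨_, g, e', h'⟩ := ih _ (by omega) (h.app (.recVal e.value b.value h)) c (by omega)
      obtain ⟨b₀, rfl⟩ := h.inv_arrow e.value
      rw [backTy_arrow] at e e'
      obtain ⟨_, e⟩ := FixLang.Eval.fix_of_app e e'
      exact ⟨_, g, e, h'.mono (by omega)⟩
  | fold h =>
    subst hΓ
    cases he with
    | fold a =>
      obtain ⟨_, _, e, h⟩ := ih _ (by omega) h a (by omega)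
      exact ⟨_, _, .inl e, .fold (h.mono (by omega))⟩
  | unfold hυ h =>
    subst hΓ; subst hυ
    cases he with
    | unfold a =>
      obtain ⟨_, _, e, h⟩ := ih _ (by omega) h a (by omega)
      obtain ⟨h0, -⟩ | ⟨_, w, _, hm, rfl, hv, h⟩ := h.inv_mu e.value
      -- The unfold itself costs one unit, so at least one is left after evaluating its argument,
      -- and the argument cannot be unknown.
      · omega
      · cases hm; cases hv
        cases e.value with | inl hw =>
        obtain ⟨_, e'⟩ := hw.eval
        exact ⟨_, w, .caseInl e e', h.mono (by omega)⟩
  | cast ha hb h ih' =>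
    subst hΓ
    obtain ⟨_, _, e, h⟩ := ih' he hk rfl
    obtain ⟨_, w, e', h'⟩ := eval_levelCast h e.value he.value
      ((Nat.sub_le _ _).trans ha) ((Nat.sub_le _ _).trans hb)
    obtain ⟨_, e⟩ := e.app_congr_right e'
    exact ⟨_, w, e, h'⟩
  | castFun ha hb hf ht h =>
    subst hΓ
    cases he.eq_of_value ht
    exact ⟨_, _, .lam, (Approx.castFun ha hb hf ht h).mono (Nat.sub_le _ _)⟩
  | unknown ht =>
    subst hΓ
    cases he.eq_of_value ht
    obtain ⟨_, e⟩ := (value_unknown _).eval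
    exact ⟨_, _, e, (Approx.unknown ht).mono (Nat.sub_le _ _)⟩
  | recVal hf hf' h =>
    subst hΓ
    cases he
    exact ⟨_, _, .lam, .recVal hf hf' h⟩

/-- Now the evaluation is given on the source side. A wrapper is opened by inverting that
evaluation, and determinism identifies its parts with the results of `eval_levelCast`. -/
theorem sound_app (ih : ∀ n' < n, Sound n') {f u w : FixLang.Tm} {ρ : FixLang.Ty}
    {b : FixLang.Tm} {f' u' : IsoLang.Tm} (h : Approx 0 [] m (.arrow σ τ) f f')
    (hf : f = .lam ρ b) (hu : Approx 0 [] m σ u u') (hv : FixLang.Value u)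
    (hv' : IsoLang.Value u') (he : FixLang.Eval (b.subst0 u) l w) (hl : l < n) :
    ∃ j v, IsoLang.Eval (.app f' u') j v ∧ Approx 0 [] m τ w v := by
  generalize hΓ : ([] : List (ℕ × IsoLang.Ty)) = Γ at h
  generalize hT : IsoLang.Ty.arrow σ τ = T at h
  generalize hK : 0 = K at h
  induction h generalizing u b ρ l w with
  | lam h =>
    subst hΓ; subst hK; cases hT; cases hf
    obtain ⟨_, v, e, h⟩ := ih l hl (h.subst0 hu) he
    obtain ⟨_, e⟩ := hv'.eval_beta e
    exact ⟨_, v, e, h⟩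
  | @castFun k Γ a c σ₀ τ₀ f t ha hc hf' _ h ih' =>
    subst hΓ; subst hK; cases hT; cases hf
    obtain ⟨_, u₂, e₂, hu₂⟩ := eval_levelCast hu hv hv' hc ha
    rw [castFun_body_subst0] at he
    cases he with
    | app a₁ b₁ c₁ =>
      cases b₁ with
      | app a₂ b₂ c₂ =>
        cases b₂.deterministic e₂
        obtain ⟨_, v, e, h₃⟩ := ih' (a₂.eq_of_value hf').symm hu₂ e₂.value c₂ (by omega)
          rfl rfl rfl
        obtain ⟨_, w₄, e₄, h₄⟩ := eval_levelCast (b := c) h₃ c₂.value e.value ha hc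
        obtain ⟨_, e₃⟩ := c₂.value.eval
        -- The conversion found by `eval_levelCast` is the one that the given evaluation performs on
        -- the result.
        cases e₄.deterministic (.app a₁ e₃ c₁)
        exact ⟨_, v, e, h₄⟩
  | @recVal k Γ m τ₁ τ₂ ρ₁ ρ₂ F F' hF hF' h _ =>
    subst hΓ; subst hK; cases hT; cases hf
    have hr := Approx.recVal (ρ₁ := ρ₁) (ρ₂ := ρ₂) hF hF' h
    rw [recVal_body_subst0] at he
    cases he with
    | app a b c =>
      cases b.eq_of_value hv
      cases a with
      | fix a₁ a₂ =>
        cases a₁.eq_of_value hF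
        obtain ⟨_, g, eg, hg⟩ := ih _ (by omega) (h.app hr) (.app .lam .lam a₂)
        obtain ⟨_, v, e, hw⟩ := ih _ (by omega) (hg.app hu) (.app .lam b c)
        obtain ⟨_, eg⟩ := eval_unfold_fold_zInst eg
        obtain ⟨_, e⟩ := eg.app_congr_left e
        rw [← zVal_body_subst0] at e
        obtain ⟨_, e⟩ := hv'.eval_beta e
        exact ⟨_, v, e, hw⟩
  | _ => first | (cases hT; done) | cases hf

/-- Index `0` suffices: monotonicity lowers any index to it, and the weak case it admits, an unknown
value, diverges as soon as it is unfolded. -/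
theorem sound (n : ℕ) : Sound n := by
  induction n using Nat.strong_induction_on with
  | _ n ih =>
  intro m τ s w t h he
  generalize hΓ : ([] : List (ℕ × IsoLang.Ty)) = Γ at h
  generalize hK : 0 = K at h
  -- Case analysis is enough here: a conversion is an application on the source side, so it carries
  -- weight of its own.
  cases h with
  | var h => subst hΓ; simp at h
  | unit => cases he; exact ⟨_, _, .unit, .unit⟩
  | tt => cases he; exact ⟨_, _, .tt, .tt⟩
  | ff => cases he; exact ⟨_, _, .ff, .ff⟩
  | lam h => subst hΓ; subst hK; cases he; exact ⟨_, _, .lam, .lam h⟩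
  | app h₁ h₂ =>
    subst hΓ; subst hK
    cases he with
    | app a b c =>
      obtain ⟨_, f, e₁, h₁⟩ := ih _ (by omega) h₁ a
      obtain ⟨_, u, e₂, h₂⟩ := ih _ (by omega) h₂ b
      obtain ⟨_, w, e, hw⟩ := sound_app ih h₁ rfl h₂ b.value e₂.value c (by omega)
      obtain ⟨_, e⟩ := e₂.app_congr_right e
      obtain ⟨_, e⟩ := e₁.app_congr_left e
      exact ⟨_, w, e, hw⟩
  | fst h =>
    subst hΓ; subst hK
    cases he with
    | fst a =>
      obtain ⟨_, _, e, h⟩ := ih _ (by omega) h a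
      obtain ⟨_, _, _, _, hv, rfl, h, -⟩ := h.inv_prod a.value
      cases hv
      exact ⟨_, _, .fst e, h⟩
  | snd h =>
    subst hΓ; subst hK
    cases he with
    | snd a =>
      obtain ⟨_, _, e, h⟩ := ih _ (by omega) h a
      obtain ⟨_, _, _, _, hv, rfl, -, h⟩ := h.inv_prod a.value
      cases hv
      exact ⟨_, _, .snd e, h⟩
  | pair h₁ h₂ =>
    subst hΓ; subst hK
    cases he with
    | pair a b =>
      obtain ⟨_, _, e₁, h₁⟩ := ih _ (by omega) h₁ a
      obtain ⟨_, _, e₂, h₂⟩ := ih _ (by omega) h₂ b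
      exact ⟨_, _, .pair e₁ e₂, .pair h₁ h₂⟩
  | inl h =>
    subst hΓ; subst hK
    cases he with
    | inl a =>
      obtain ⟨_, _, e, h⟩ := ih _ (by omega) h a
      exact ⟨_, _, .inl e, .inl h⟩
  | inr h =>
    subst hΓ; subst hK
    cases he with
    | inr a =>
      obtain ⟨_, _, e, h⟩ := ih _ (by omega) h a
      exact ⟨_, _, .inr e, .inr h⟩
  | caseOf h h₁ h₂ =>
    subst hΓ; subst hK
    cases he with
    | caseInl a b =>
      obtain ⟨_, _, e, h⟩ := ih _ (by omega) h a
      obtain ⟨_, _, hv, rfl, h⟩ | ⟨_, _, hv, -⟩ := h.inv_sum a.value <;> cases hv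
      obtain ⟨_, _, e', h'⟩ := ih _ (by omega) (h₁.subst0 h) b
      exact ⟨_, _, .caseInl e e', h'⟩
    | caseInr a b =>
      obtain ⟨_, _, e, h⟩ := ih _ (by omega) h a
      obtain ⟨_, _, hv, -⟩ | ⟨_, _, hv, rfl, h⟩ := h.inv_sum a.value <;> cases hv
      obtain ⟨_, _, e', h'⟩ := ih _ (by omega) (h₂.subst0 h) b
      exact ⟨_, _, .caseInr e e', h'⟩
  | ite h h₁ h₂ =>
    subst hΓ; subst hK
    cases he with
    | iteTrue a b =>
      obtain ⟨_, _, e, h⟩ := ih _ (by omega) h a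
      obtain ⟨hv, rfl⟩ | ⟨hv, -⟩ := h.inv_bool a.value <;> cases hv
      obtain ⟨_, _, e', h'⟩ := ih _ (by omega) h₁ b
      exact ⟨_, _, .iteTrue e e', h'⟩
    | iteFalse a b =>
      obtain ⟨_, _, e, h⟩ := ih _ (by omega) h a
      obtain ⟨hv, -⟩ | ⟨hv, rfl⟩ := h.inv_bool a.value <;> cases hv
      obtain ⟨_, _, e', h'⟩ := ih _ (by omega) h₂ b
      exact ⟨_, _, .iteFalse e e', h'⟩
  | seq h₁ h₂ =>
    subst hΓ; subst hK
    cases he with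
    | seq a b =>
      obtain ⟨_, _, e, h⟩ := ih _ (by omega) h₁ a
      obtain ⟨-, rfl⟩ := h.inv_unit a.value
      obtain ⟨_, _, e', h'⟩ := ih _ (by omega) h₂ b
      exact ⟨_, _, .seq e e', h'⟩
  | fix h =>
    subst hΓ; subst hK
    cases he with
    | fix a b =>
      rw [← backTy_arrow] at a b
      obtain ⟨_, f, e, h⟩ := ih _ (by omega) h a
      obtain ⟨_, v, e', h'⟩ := ih _ (by omega) (h.app (.recVal a.value e.value h))
        (.app .lam .lam b)
      obtain ⟨_, e⟩ := eval_zComb e e'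
      exact ⟨_, v, e, h'⟩
  | fold h =>
    subst hΓ; subst hK
    cases he with
    | inl a =>
      obtain ⟨_, _, e, h⟩ := ih _ (by omega) h a
      exact ⟨_, _, .fold e, .fold h⟩
  | unfold hυ h =>
    subst hΓ; subst hK; subst hυ
    cases he with
    | caseInl a b =>
      cases a.value with | inl hw =>
      cases b.eq_of_value hw
      obtain ⟨_, _, e, h⟩ := ih _ (by omega) h a
      obtain ⟨-, hv⟩ | ⟨_, _, _, hm, hv, rfl, h⟩ := h.inv_mu a.value <;> cases hv
      cases hm
      exact ⟨_, _, .unfold e, h⟩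
    | caseInr a b => exact absurd b (eval_diverge _ _ _)
  | cast ha hb h =>
    subst hΓ; subst hK
    cases he with
    | app a b c =>
      obtain ⟨_, v, e, h⟩ := ih _ (by omega) h b
      obtain ⟨_, w', e', h'⟩ := eval_levelCast h b.value e.value ha hb
      obtain ⟨_, e''⟩ := b.app_congr_right e'
      cases e''.deterministic (.app a b c)
      exact ⟨_, v, e, h'⟩
  | castFun ha hb hf ht h =>
    subst hΓ; subst hK
    cases he
    obtain ⟨_, e⟩ := ht.eval
    exact ⟨_, _, e, .castFun ha hb hf ht h⟩
  | unknown ht =>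
    subst hΓ
    cases he.eq_of_value (value_unknown _)
    obtain ⟨_, e⟩ := ht.eval
    exact ⟨_, _, e, .unknown ht⟩
  | recVal hf hf' h =>
    subst hΓ; subst hK
    cases he
    exact ⟨_, _, .lam, .recVal hf hf' h⟩

end Approx

/-! ### Typing of compiled terms and the compiler on contexts. -/

theorem compileTy_wf (n : ℕ) (τ : FixLang.Ty) : (compileTy τ).WF n := by
  induction τ <;> simp_all [compileTy, IsoLang.Ty.WF]

theorem compileTy_subst (τ : FixLang.Ty) (θ : ℕ → IsoLang.Ty) :
    (compileTy τ).subst θ = compileTy τ := by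
  induction τ <;> simp_all [compileTy, IsoLang.Ty.subst]

theorem hasType_zComb (Γ : List IsoLang.Ty) (τ₁ τ₂ : FixLang.Ty) :
    IsoLang.HasType Γ (zComb (compileTy τ₁) (compileTy τ₂))
      (.arrow (compileTy (.arrow (.arrow τ₁ τ₂) (.arrow τ₁ τ₂))) (compileTy (.arrow τ₁ τ₂))) := by
  have hv : (IsoLang.Ty.mu (selfBody (compileTy τ₁) (compileTy τ₂))).Valid :=
    ⟨id, Nat.zero_lt_one, compileTy_wf _ _, compileTy_wf _ _⟩
  -- Compiled types are closed, so the substitution only touches the variable in front of the outer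
  -- arrow.
  have hu : (selfBody (compileTy τ₁) (compileTy τ₂)).unfolding =
      .arrow (.mu (selfBody (compileTy τ₁) (compileTy τ₂)))
        (.arrow (compileTy τ₁) (compileTy τ₂)) := by
    simp [IsoLang.Ty.unfolding, selfBody, IsoLang.Ty.subst, IsoLang.Ty.single, compileTy_subst]
  have hz : ∀ Δ, IsoLang.HasType
      (.arrow (.arrow (compileTy τ₁) (compileTy τ₂)) (.arrow (compileTy τ₁) (compileTy τ₂)) :: Δ)
      (zHalf (compileTy τ₁) (compileTy τ₂))
      (.arrow (.mu (selfBody (compileTy τ₁) (compileTy τ₂)))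
        (.arrow (compileTy τ₁) (compileTy τ₂))) := fun Δ =>
    .lam hv (.app (.var rfl) (.lam (compileTy_wf _ _)
      (.app (.app (hu ▸ .unfold hv (.var rfl)) (.var rfl)) (.var rfl))))
  exact .lam (compileTy_wf _ (.arrow (.arrow τ₁ τ₂) (.arrow τ₁ τ₂)))
    (.app (hz _) (.fold hv (hu ▸ hz _)))

/-- The compiler preserves typing. -/
theorem FixLang.HasType.compile {Γ : List FixLang.Ty} {t : FixLang.Tm} {τ : FixLang.Ty}
    (h : FixLang.HasType Γ t τ) :
    IsoLang.HasType (Γ.map compileTy) (compile t) (compileTy τ) := by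
  induction h with
  | var h => exact .var (by simp [h])
  | unit => exact .unit
  | tt => exact .tt
  | ff => exact .ff
  | lam _ ih => exact .lam (compileTy_wf _ _) ih
  | app _ _ ih₁ ih₂ => exact .app ih₁ ih₂
  | fst _ ih => exact .fst ih
  | snd _ ih => exact .snd ih
  | pair _ _ ih₁ ih₂ => exact .pair ih₁ ih₂
  | inl _ ih => exact .inl (compileTy_wf _ _) ih
  | inr _ ih => exact .inr (compileTy_wf _ _) ih
  | caseOf _ _ _ ih ih₁ ih₂ => exact .caseOf ih ih₁ ih₂
  | ite _ _ _ ih ih₁ ih₂ => exact .ite ih ih₁ ih₂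
  | seq _ _ ih₁ ih₂ => exact .seq ih₁ ih₂
  | fix _ ih => exact .app (hasType_zComb _ _ _) ih

/-- The compiler reflects typing, up to erasure of recursive types. -/
theorem hasType_of_compile {Γ : List IsoLang.Ty} {t : FixLang.Tm} {τ : IsoLang.Ty}
    (h : IsoLang.HasType Γ (compile t) τ) :
    FixLang.HasType (Γ.map (backTy 0)) t (backTy 0 τ) := by
  induction t generalizing Γ τ with
  | var i => cases h with | var h => exact .var (by simp [h])
  | unit => cases h; exact .unit
  | tt => cases h; exact .tt
  | ff => cases h; exact .ff
  | lam σ t ih =>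
    cases h with
    | lam _ h => rw [backTy_arrow, backTy_compileTy]; exact .lam (by simpa using ih h)
  | app t u ih₁ ih₂ =>
    cases h with | app h₁ h₂ => exact .app (by simpa using ih₁ h₁) (ih₂ h₂)
  | fst t ih => cases h with | fst h => exact .fst (by simpa using ih h)
  | snd t ih => cases h with | snd h => exact .snd (by simpa using ih h)
  | pair t u ih₁ ih₂ =>
    cases h with | pair h₁ h₂ => rw [backTy_prod]; exact .pair (ih₁ h₁) (ih₂ h₂)
  | inl t ih => cases h with | inl _ h => rw [backTy_sum]; exact .inl (ih h)
  | inr t ih => cases h with | inr _ h => rw [backTy_sum]; exact .inr (ih h)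
  | caseOf t u w ih ih₁ ih₂ =>
    cases h with
    | caseOf h h₁ h₂ => exact .caseOf (by simpa using ih h) (ih₁ h₁) (ih₂ h₂)
  | ite t u w ih ih₁ ih₂ =>
    cases h with | ite h h₁ h₂ => exact .ite (by simpa using ih h) (ih₁ h₁) (ih₂ h₂)
  | seq t u ih₁ ih₂ =>
    cases h with | seq h₁ h₂ => exact .seq (by simpa using ih₁ h₁) (ih₂ h₂)
  | fix τ₁ τ₂ t ih =>
    cases h with
    | app hz h =>
      cases hz with
      | lam _ hz =>
        cases hz with
        | app hz _ =>
          cases hz with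
          | lam _ hz =>
            cases hz with
            | app hz _ =>
              cases hz with
              | var hz =>
                -- The result type of the Z-combinator is read off from its variable `f`, whose type
                -- is the compiled annotation.
                cases hz
                simpa using FixLang.HasType.fix (τ₁ := τ₁) (τ₂ := τ₂) (by simpa using ih h)

/-- The compiler on program contexts. -/
def compileCtx : FixLang.Ctx → IsoLang.Ctx
  | .hole => .hole
  | .lam τ C => .lam (compileTy τ) (compileCtx C)
  | .appL C u => .appL (compileCtx C) (compile u)
  | .appR u C => .appR (compile u) (compileCtx C)
  | .fst C => .fst (compileCtx C)
  | .snd C => .snd (compileCtx C)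
  | .pairL C u => .pairL (compileCtx C) (compile u)
  | .pairR u C => .pairR (compile u) (compileCtx C)
  | .inl C => .inl (compileCtx C)
  | .inr C => .inr (compileCtx C)
  | .case₁ C u w => .case₁ (compileCtx C) (compile u) (compile w)
  | .case₂ s C w => .case₂ (compile s) (compileCtx C) (compile w)
  | .case₃ s u C => .case₃ (compile s) (compile u) (compileCtx C)
  | .ite₁ C u w => .ite₁ (compileCtx C) (compile u) (compile w)
  | .ite₂ s C w => .ite₂ (compile s) (compileCtx C) (compile w)
  | .ite₃ s u C => .ite₃ (compile s) (compile u) (compileCtx C)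
  | .seqL C u => .seqL (compileCtx C) (compile u)
  | .seqR u C => .seqR (compile u) (compileCtx C)
  | .fix σ τ C => .appR (zComb (compileTy σ) (compileTy τ)) (compileCtx C)

theorem compile_plug (C : FixLang.Ctx) (t : FixLang.Tm) :
    compile (C.plug t) = (compileCtx C).plug (compile t) := by
  induction C <;> simp_all [FixLang.Ctx.plug, compileCtx, IsoLang.Ctx.plug, compile]

theorem FixLang.Ctx.HasType.compileCtx {C : FixLang.Ctx} {Γ₀ Γ : List FixLang.Ty}
    {τ₀ τ : FixLang.Ty} (h : C.HasType Γ₀ τ₀ Γ τ) :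
    (compileCtx C).HasType (Γ₀.map compileTy) (compileTy τ₀) (Γ.map compileTy)
      (compileTy τ) := by
  induction h with
  | hole => exact .hole
  | lam _ ih => exact .lam (compileTy_wf _ _) ih
  | appL _ h ih => exact .appL ih h.compile
  | appR h _ ih => exact .appR h.compile ih
  | fst _ ih => exact .fst ih
  | snd _ ih => exact .snd ih
  | pairL _ h ih => exact .pairL ih h.compile
  | pairR h _ ih => exact .pairR h.compile ih
  | inl _ ih => exact .inl (compileTy_wf _ _) ih
  | inr _ ih => exact .inr (compileTy_wf _ _) ih
  | case₁ _ h₁ h₂ ih => exact .case₁ ih h₁.compile h₂.compile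
  | case₂ h₁ _ h₂ ih => exact .case₂ h₁.compile ih h₂.compile
  | case₃ h₁ h₂ _ ih => exact .case₃ h₁.compile h₂.compile ih
  | ite₁ _ h₁ h₂ ih => exact .ite₁ ih h₁.compile h₂.compile
  | ite₂ h₁ _ h₂ ih => exact .ite₂ h₁.compile ih h₂.compile
  | ite₃ h₁ h₂ _ ih => exact .ite₃ h₁.compile h₂.compile ih
  | seqL _ h ih => exact .seqL ih h.compile
  | seqR h _ ih => exact .seqR h.compile ih
  | fix _ ih => exact .appR (hasType_zComb _ _ _) ih

theorem FixLang.Ctx.HasType.plug {C : FixLang.Ctx} {Γ₀ Γ : List FixLang.Ty}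
    {τ₀ τ : FixLang.Ty} (h : C.HasType Γ₀ τ₀ Γ τ) {t : FixLang.Tm} (ht : FixLang.HasType Γ₀ t τ₀) :
    FixLang.HasType Γ (C.plug t) τ := by
  induction h with
  | hole => exact ht
  | lam _ ih => exact .lam (ih ht)
  | appL _ h ih => exact .app (ih ht) h
  | appR h _ ih => exact .app h (ih ht)
  | fst _ ih => exact .fst (ih ht)
  | snd _ ih => exact .snd (ih ht)
  | pairL _ h ih => exact .pair (ih ht) h
  | pairR h _ ih => exact .pair h (ih ht)
  | inl _ ih => exact .inl (ih ht)
  | inr _ ih => exact .inr (ih ht)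
  | case₁ _ h₁ h₂ ih => exact .caseOf (ih ht) h₁ h₂
  | case₂ h₁ _ h₂ ih => exact .caseOf h₁ (ih ht) h₂
  | case₃ h₁ h₂ _ ih => exact .caseOf h₁ h₂ (ih ht)
  | ite₁ _ h₁ h₂ ih => exact .ite (ih ht) h₁ h₂
  | ite₂ h₁ _ h₂ ih => exact .ite h₁ (ih ht) h₂
  | ite₃ h₁ h₂ _ ih => exact .ite h₁ h₂ (ih ht)
  | seqL _ h ih => exact .seq (ih ht) h
  | seqR h _ ih => exact .seq h (ih ht)
  | fix _ ih => exact .fix (ih ht)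

/-! ### Self-approximation of compiled terms and back-translation. -/

namespace Approx

/-- A term approximates its compilation. -/
theorem compile {Γ : List FixLang.Ty} {t : FixLang.Tm} {τ : FixLang.Ty}
    (h : FixLang.HasType Γ t τ) (k m : ℕ) :
    Approx k (Γ.map fun σ => (m, compileTy σ)) m (compileTy τ) t (compile t) := by
  induction h with
  | var h => exact .var (by simp [h])
  | unit => exact .unit
  | tt => exact .tt
  | ff => exact .ff
  | @lam _ σ _ _ _ ih =>
    have := Approx.lam (ρ := compileTy σ) ih
    rw [backTy_compileTy] at this
    exact this
  | app _ _ ih₁ ih₂ => exact .app ih₁ ih₂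
  | fst _ ih => exact .fst ih
  | snd _ ih => exact .snd ih
  | pair _ _ ih₁ ih₂ => exact .pair ih₁ ih₂
  | inl _ ih => exact .inl ih
  | inr _ ih => exact .inr ih
  | caseOf _ _ _ ih ih₁ ih₂ => exact .caseOf ih ih₁ ih₂
  | ite _ _ _ ih ih₁ ih₂ => exact .ite ih ih₁ ih₂
  | seq _ _ ih₁ ih₂ => exact .seq ih₁ ih₂
  | @fix _ τ₁ τ₂ _ _ ih =>
    have := Approx.fix (ρ₁ := compileTy τ₁) (ρ₂ := compileTy τ₂) ih
    simp only [backTy_compileTy] at this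
    exact this

theorem terminates {k m n : ℕ} {τ : IsoLang.Ty} {s : FixLang.Tm} {t v : IsoLang.Tm}
    (h : Approx k [] m τ s t) (he : IsoLang.Eval t n v) (hn : n ≤ k) : FixLang.Terminates s :=
  have ⟨j, w, e, _⟩ := complete n h he hn
  FixLang.terminates_iff_eval.2 ⟨j, w, e⟩

theorem terminates_of_terminates {k m : ℕ} {τ : IsoLang.Ty} {s : FixLang.Tm} {t : IsoLang.Tm}
    (h : Approx k [] m τ s t) (hs : FixLang.Terminates s) : IsoLang.Terminates t :=
  have ⟨n, _, e⟩ := FixLang.terminates_iff_eval.1 hs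
  have ⟨j, v, e, _⟩ := sound n (h.mono (Nat.zero_le k)) e
  IsoLang.terminates_iff_eval.2 ⟨j, v, e⟩

/-- Back-translation keeps all terms at level `k + 1`, but a fold at that level expects contents at
level `k`, so these are converted down first. -/
theorem backFold {k Γ τ s t} (h : Approx k Γ (k + 1) τ.unfolding s t) :
    Approx k Γ (k + 1) (.mu τ) (.inl (.app (levelCast (k + 1) k τ.unfolding) s)) (.fold τ t) :=
  .fold (.cast (by omega) (by omega) (h.mono (Nat.sub_le _ _)))

/-- Unfolding lands at level `k`, and conversion restores level `k + 1`. The bound of the index by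
the lower level explains the choice of `k + 1`. -/
theorem backUnfold {k Γ τ s t} (h : Approx k Γ (k + 1) (.mu τ) s t) :
    Approx k Γ (k + 1) τ.unfolding (.app (levelCast k (k + 1) τ.unfolding)
      (.caseOf s (.var 0) (diverge (backTy k τ.unfolding)))) (.unfold τ t) :=
  .cast le_rfl (Nat.le_succ k) (.unfold rfl h)

end Approx

theorem hasType_backFold {k : ℕ} {Γ : List FixLang.Ty} {τ : IsoLang.Ty} {s : FixLang.Tm}
    (h : FixLang.HasType Γ s (backTy (k + 1) τ.unfolding)) :
    FixLang.HasType Γ (.inl (.app (levelCast (k + 1) k τ.unfolding) s)) (backTy (k + 1) (.mu τ)) :=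
  .inl (.app (hasType_levelCast _ _ _ _) h)

theorem hasType_backUnfold {k : ℕ} {Γ : List FixLang.Ty} {τ : IsoLang.Ty} {s : FixLang.Tm}
    (h : FixLang.HasType Γ s (backTy (k + 1) (.mu τ))) :
    FixLang.HasType Γ (.app (levelCast k (k + 1) τ.unfolding)
      (.caseOf s (.var 0) (diverge (backTy k τ.unfolding)))) (backTy (k + 1) τ.unfolding) :=
  .app (hasType_levelCast _ _ _ _) (.caseOf h (.var rfl) (hasType_diverge _ _))

/-- Back-translation of terms: every typed term of `IsoLang` is approximated, at any precision, by a
typed term of `FixLang`. -/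
theorem exists_approx {Γ : List IsoLang.Ty} {t : IsoLang.Tm} {τ : IsoLang.Ty}
    (h : IsoLang.HasType Γ t τ) (k : ℕ) :
    ∃ s, FixLang.HasType (Γ.map (backTy (k + 1))) s (backTy (k + 1) τ) ∧
      Approx k (Γ.map fun σ => (k + 1, σ)) (k + 1) τ s t := by
  induction h with
  | @var _ i _ h => exact ⟨.var i, .var (by simp [h]), .var (by simp [h])⟩
  | unit => exact ⟨.unit, by rw [backTy_unit]; exact .unit, .unit⟩
  | tt => exact ⟨.tt, by rw [backTy_bool]; exact .tt, .tt⟩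
  | ff => exact ⟨.ff, by rw [backTy_bool]; exact .ff, .ff⟩
  | lam _ _ ih =>
    obtain ⟨s, hs, ha⟩ := ih
    exact ⟨_, by rw [backTy_arrow]; exact .lam hs, .lam ha⟩
  | app _ _ ih₁ ih₂ =>
    obtain ⟨s₁, hs₁, ha₁⟩ := ih₁
    obtain ⟨s₂, hs₂, ha₂⟩ := ih₂
    rw [backTy_arrow] at hs₁
    exact ⟨_, .app hs₁ hs₂, .app ha₁ ha₂⟩
  | fst _ ih =>
    obtain ⟨s, hs, ha⟩ := ih
    rw [backTy_prod] at hs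
    exact ⟨_, .fst hs, .fst ha⟩
  | snd _ ih =>
    obtain ⟨s, hs, ha⟩ := ih
    rw [backTy_prod] at hs
    exact ⟨_, .snd hs, .snd ha⟩
  | pair _ _ ih₁ ih₂ =>
    obtain ⟨s₁, hs₁, ha₁⟩ := ih₁
    obtain ⟨s₂, hs₂, ha₂⟩ := ih₂
    exact ⟨_, by rw [backTy_prod]; exact .pair hs₁ hs₂, .pair ha₁ ha₂⟩
  | inl _ _ ih =>
    obtain ⟨s, hs, ha⟩ := ih
    exact ⟨_, by rw [backTy_sum]; exact .inl hs, .inl ha⟩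
  | inr _ _ ih =>
    obtain ⟨s, hs, ha⟩ := ih
    exact ⟨_, by rw [backTy_sum]; exact .inr hs, .inr ha⟩
  | caseOf _ _ _ ih ih₁ ih₂ =>
    obtain ⟨s, hs, ha⟩ := ih
    obtain ⟨s₁, hs₁, ha₁⟩ := ih₁
    obtain ⟨s₂, hs₂, ha₂⟩ := ih₂
    rw [backTy_sum] at hs
    exact ⟨_, .caseOf hs hs₁ hs₂, .caseOf ha ha₁ ha₂⟩
  | ite _ _ _ ih ih₁ ih₂ =>
    obtain ⟨s, hs, ha⟩ := ih
    obtain ⟨s₁, hs₁, ha₁⟩ := ih₁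
    obtain ⟨s₂, hs₂, ha₂⟩ := ih₂
    rw [backTy_bool] at hs
    exact ⟨_, .ite hs hs₁ hs₂, .ite ha ha₁ ha₂⟩
  | seq _ _ ih₁ ih₂ =>
    obtain ⟨s₁, hs₁, ha₁⟩ := ih₁
    obtain ⟨s₂, hs₂, ha₂⟩ := ih₂
    rw [backTy_unit] at hs₁
    exact ⟨_, .seq hs₁ hs₂, .seq ha₁ ha₂⟩
  | fold _ _ ih =>
    obtain ⟨s, hs, ha⟩ := ih
    exact ⟨_, hasType_backFold hs, ha.backFold⟩
  | unfold _ _ ih =>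
    obtain ⟨s, hs, ha⟩ := ih
    exact ⟨_, hasType_backUnfold hs, ha.backUnfold⟩

/-- Back-translation of program contexts. -/
theorem exists_approx_ctx {C : IsoLang.Ctx} {Γ₀ Γ : List IsoLang.Ty} {τ₀ τ : IsoLang.Ty}
    (h : C.HasType Γ₀ τ₀ Γ τ) (k : ℕ) :
    ∃ D : FixLang.Ctx,
      D.HasType (Γ₀.map (backTy (k + 1))) (backTy (k + 1) τ₀) (Γ.map (backTy (k + 1)))
        (backTy (k + 1) τ) ∧
      -- The context is fixed before the terms: the same one must serve both sides of an
      -- equivalence.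
      ∀ s t, Approx k (Γ₀.map fun σ => (k + 1, σ)) (k + 1) τ₀ s t →
        Approx k (Γ.map fun σ => (k + 1, σ)) (k + 1) τ (D.plug s) (C.plug t) := by
  induction h with
  | hole => exact ⟨.hole, .hole, fun _ _ h => h⟩
  | @lam _ _ _ σ _ _ _ _ ih =>
    obtain ⟨D, hD, hp⟩ := ih
    exact ⟨.lam (backTy (k + 1) σ) D, by rw [backTy_arrow]; exact .lam hD,
      fun s t h => .lam (hp s t h)⟩
  | appL _ hu ih =>
    obtain ⟨D, hD, hp⟩ := ih
    obtain ⟨u, hu, hau⟩ := exists_approx hu k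
    rw [backTy_arrow] at hD
    exact ⟨.appL D u, .appL hD hu, fun s t h => .app (hp s t h) hau⟩
  | appR hu _ ih =>
    obtain ⟨D, hD, hp⟩ := ih
    obtain ⟨u, hu, hau⟩ := exists_approx hu k
    rw [backTy_arrow] at hu
    exact ⟨.appR u D, .appR hu hD, fun s t h => .app hau (hp s t h)⟩
  | fst _ ih =>
    obtain ⟨D, hD, hp⟩ := ih
    rw [backTy_prod] at hD
    exact ⟨.fst D, .fst hD, fun s t h => .fst (hp s t h)⟩
  | snd _ ih =>
    obtain ⟨D, hD, hp⟩ := ih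
    rw [backTy_prod] at hD
    exact ⟨.snd D, .snd hD, fun s t h => .snd (hp s t h)⟩
  | pairL _ hu ih =>
    obtain ⟨D, hD, hp⟩ := ih
    obtain ⟨u, hu, hau⟩ := exists_approx hu k
    exact ⟨.pairL D u, by rw [backTy_prod]; exact .pairL hD hu,
      fun s t h => .pair (hp s t h) hau⟩
  | pairR hu _ ih =>
    obtain ⟨D, hD, hp⟩ := ih
    obtain ⟨u, hu, hau⟩ := exists_approx hu k
    exact ⟨.pairR u D, by rw [backTy_prod]; exact .pairR hu hD,
      fun s t h => .pair hau (hp s t h)⟩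
  | inl _ _ ih =>
    obtain ⟨D, hD, hp⟩ := ih
    exact ⟨.inl D, by rw [backTy_sum]; exact .inl hD, fun s t h => .inl (hp s t h)⟩
  | inr _ _ ih =>
    obtain ⟨D, hD, hp⟩ := ih
    exact ⟨.inr D, by rw [backTy_sum]; exact .inr hD, fun s t h => .inr (hp s t h)⟩
  | case₁ _ h₁ h₂ ih =>
    obtain ⟨D, hD, hp⟩ := ih
    obtain ⟨u, hu, hau⟩ := exists_approx h₁ k
    obtain ⟨w, hw, haw⟩ := exists_approx h₂ k
    rw [backTy_sum] at hD
    exact ⟨.case₁ D u w, .case₁ hD hu hw, fun s t h => .caseOf (hp s t h) hau haw⟩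
  | case₂ h₁ _ h₂ ih =>
    obtain ⟨D, hD, hp⟩ := ih
    obtain ⟨u, hu, hau⟩ := exists_approx h₁ k
    obtain ⟨w, hw, haw⟩ := exists_approx h₂ k
    rw [backTy_sum] at hu
    exact ⟨.case₂ u D w, .case₂ hu hD hw, fun s t h => .caseOf hau (hp s t h) haw⟩
  | case₃ h₁ h₂ _ ih =>
    obtain ⟨D, hD, hp⟩ := ih
    obtain ⟨u, hu, hau⟩ := exists_approx h₁ k
    obtain ⟨w, hw, haw⟩ := exists_approx h₂ k
    rw [backTy_sum] at hu
    exact ⟨.case₃ u w D, .case₃ hu hw hD, fun s t h => .caseOf hau haw (hp s t h)⟩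
  | ite₁ _ h₁ h₂ ih =>
    obtain ⟨D, hD, hp⟩ := ih
    obtain ⟨u, hu, hau⟩ := exists_approx h₁ k
    obtain ⟨w, hw, haw⟩ := exists_approx h₂ k
    rw [backTy_bool] at hD
    exact ⟨.ite₁ D u w, .ite₁ hD hu hw, fun s t h => .ite (hp s t h) hau haw⟩
  | ite₂ h₁ _ h₂ ih =>
    obtain ⟨D, hD, hp⟩ := ih
    obtain ⟨u, hu, hau⟩ := exists_approx h₁ k
    obtain ⟨w, hw, haw⟩ := exists_approx h₂ k
    rw [backTy_bool] at hu
    exact ⟨.ite₂ u D w, .ite₂ hu hD hw, fun s t h => .ite hau (hp s t h) haw⟩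
  | ite₃ h₁ h₂ _ ih =>
    obtain ⟨D, hD, hp⟩ := ih
    obtain ⟨u, hu, hau⟩ := exists_approx h₁ k
    obtain ⟨w, hw, haw⟩ := exists_approx h₂ k
    rw [backTy_bool] at hu
    exact ⟨.ite₃ u w D, .ite₃ hu hw hD, fun s t h => .ite hau haw (hp s t h)⟩
  | seqL _ hu ih =>
    obtain ⟨D, hD, hp⟩ := ih
    obtain ⟨u, hu, hau⟩ := exists_approx hu k
    rw [backTy_unit] at hD
    exact ⟨.seqL D u, .seqL hD hu, fun s t h => .seq (hp s t h) hau⟩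
  | seqR hu _ ih =>
    obtain ⟨D, hD, hp⟩ := ih
    obtain ⟨u, hu, hau⟩ := exists_approx hu k
    rw [backTy_unit] at hu
    exact ⟨.seqR u D, .seqR hu hD, fun s t h => .seq hau (hp s t h)⟩
  | @fold _ _ _ τ _ _ _ ih =>
    obtain ⟨D, hD, hp⟩ := ih
    exact ⟨.inl (.appR (levelCast (k + 1) k τ.unfolding) D),
      .inl (.appR (hasType_levelCast _ _ _ _) hD), fun s t h => (hp s t h).backFold⟩
  | @unfold _ _ _ τ _ _ _ ih =>
    obtain ⟨D, hD, hp⟩ := ih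
    exact ⟨.appR (levelCast k (k + 1) τ.unfolding)
        (.case₁ D (.var 0) (diverge (backTy k τ.unfolding))),
      .appR (hasType_levelCast _ _ _ _) (.case₁ hD (.var rfl) (hasType_diverge _ _)),
      fun s t h => (hp s t h).backUnfold⟩

/-! ### Full abstraction. -/

/-- A closed term terminates if and only if its compilation does. -/
theorem terminates_compile_iff {t : FixLang.Tm} {τ : FixLang.Ty} (h : FixLang.HasType [] t τ) :
    IsoLang.Terminates (compile t) ↔ FixLang.Terminates t := by
  constructor
  · intro ht
    obtain ⟨n, v, e⟩ := IsoLang.terminates_iff_eval.1 ht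
    -- The index is the weight of the given evaluation. Level `0` suffices because
    -- self-approximation contains no level conversion.
    exact (Approx.compile h n 0).terminates e le_rfl
  · exact (Approx.compile h 0 0).terminates_of_terminates

/-- Program contexts of `IsoLang` cannot separate compilations of contextually equivalent terms. -/
theorem FixLang.CtxEquiv.terminates_plug_compile {t₁ t₂ : FixLang.Tm} {τ : FixLang.Ty}
    (h : FixLang.CtxEquiv [] t₁ t₂ τ) {C : IsoLang.Ctx} {τ' : IsoLang.Ty}
    (hC : C.HasType [] (compileTy τ) [] τ') (ht : IsoLang.Terminates (C.plug (compile t₁))) :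
    IsoLang.Terminates (C.plug (compile t₂)) := by
  obtain ⟨h₁, h₂, h⟩ := h
  obtain ⟨n, v, e⟩ := IsoLang.terminates_iff_eval.1 ht
  obtain ⟨D, hD, hp⟩ := exists_approx_ctx hC n
  rw [backTy_compileTy] at hD
  -- The weight `n` is tied to `t₁` alone. The run with `t₂` may be much longer, but soundness needs
  -- no bound.
  exact (hp _ _ (Approx.compile h₂ n _)).terminates_of_terminates
    ((h D _ hD).1 ((hp _ _ (Approx.compile h₁ n _)).terminates e le_rfl))

theorem mainTheorem1 (t₁ t₂ : FixLang.Tm) (τ : FixLang.Ty) :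
    FixLang.CtxEquiv [] t₁ t₂ τ ↔
      IsoLang.CtxEquiv [] (compile t₁) (compile t₂) (compileTy τ) := by
  constructor
  · intro h
    have h' : FixLang.CtxEquiv [] t₂ t₁ τ :=
      ⟨h.2.1, h.1, fun C τ' hC => (h.2.2 C τ' hC).symm⟩
    exact ⟨h.1.compile, h.2.1.compile, fun C τ' hC =>
      ⟨h.terminates_plug_compile hC, h'.terminates_plug_compile hC⟩⟩
  · rintro ⟨h₁, h₂, h⟩
    have h₁ := hasType_of_compile h₁
    have h₂ := hasType_of_compile h₂
    -- Erasure may change types inside the target derivation, but it returns the source type of the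
    -- whole unchanged.
    rw [backTy_compileTy] at h₁ h₂
    refine ⟨h₁, h₂, fun C τ' hC => ?_⟩
    rw [← terminates_compile_iff (hC.plug h₁), ← terminates_compile_iff (hC.plug h₂),
      compile_plug, compile_plug]
    exact h _ _ hC.compileCtx
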